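/- Let $N\ge 1$ and $0<\lambda\le\Lambda$, let $A$ be a real symmetric $N\times N$ matrix with all eigenvalues in $[\lambda,\Lambda]$, and let $\mathcal B=\mathbb R^N\times\mathbb C$ with coordinates $(\mu_1,\dots,\mu_N,\eta)$; put $\mu_0=0$. Let $|(\mu,\eta)|_A=(\sum_{i,j} A_{ij}\mu_i\mu_j+\det A\,|\eta|^2)^{1/2}$, let $\operatorname{dist}_A$ be the corresponding distance (with $\operatorname{dist}_A(\cdot,\emptyset)=\infty$ and $C/\infty=0$), and let $\Delta_A=\sum_{i,j}(A^{-1})_{ij}\partial_{\mu_i}\partial_{\mu_j}+4(\det A)^{-1}\partial_\eta\partial_{\bar\eta}$. Let $$\pi:\mathbb C^{N+1}\to\mathcal B,\qquad \pi(z_0,\dots,z_N)=\bigl(\tfrac12(|z_1|^2-|z_0|^2),\dots,\tfrac12(|z_N|^2-|z_0|^2),\,z_0\cdots z_N\bigr).$$ For $I\subseteq\{0,\dots,N\}$ with $|I|\ge2$ put $$D_I=\pi(\{z: z_i=0\iff i\in I\}),\qquad \partial D_I=\bigcup_{I\subsetneq J}D_J,$$ and, for a constant $C_0$, $$B_I=\{p\in\mathcal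 B: C_0\operatorname{dist}_A(p,D_I)<\operatorname{dist}_A(p,\partial D_I)\}.$$ With $\alpha(N+2)$ the volume of the unit ball in $\mathbb R^{N+2}$ and $c_A=\frac{2\pi\sqrt{\det A}}{N(N+2)\alpha(N+2)}$, define for $1\le i\le N$ $$\alpha_{0i}(p)=\alpha_{i0}(p)=c_A\int_{\mathbb R_+^{N-1}}\frac{\prod_{k\ne i}dt_k}{|p-t^{(i)}|_A^{N}},$$ and for distinct $1\le i,j\le N$ $$\alpha_{ij}(p)=c_A\int_{\mathbb R_+^{N-1}}\frac{ds\,\prod_{k\ne i,j}dt_k}{|p-t^{(ij)}+s\mathbf 1|_A^{N}},$$ where $t^{(i)}$ (resp. $t^{(ij)}$) has coordinates $\mu_k=t_k$ for $k\neq i$ (resp. $k\ne i,j$) and all other coordinates $0$, and $\mathbf 1=(1,\dots,1,0)$; put $\alpha_{ii}=0$. For $i\ne j$ the function $\alpha_{ij}$ is finite exactly off $\overline{D_{\{i,j\}}}$. Then there are constants $C_*\ge1$ and $C>0$ depending only on $N,\lambda,\Lambda$, and functions $\alpha_{I,ij},\beta_{I,ij}:\mathcal B\to\mathbb R$ ($2\le|I|\le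 N+1$, $0\le i,j\le N$; at points of $\overline{D_{\{i,j\}}}$ the value of $\alpha_{I,ij}$ carries no information) with $\alpha_{I,ij}=0$ and $\beta_{I,ij}=\alpha_{ij}$ if $i\notin I$ or $j\notin I$, such that for every $I$ with $2\le|I|\le N+1$, all $i,j\in I$ and every $C_0\ge C_*$: 1. $\alpha_{ij}=\alpha_{I,ij}+\beta_{I,ij}$ wherever $\alpha_{ij}$ is finite. 2. $\alpha_{I,ij}$ depends only on $\eta$ and the differences $\mu_a-\mu_b$ with $a,b\in I$ (so, if $0\in I$, only on $\eta$ and the $\mu_a$ with $a\in I$). 3. $\beta_{I,ij}$ is smooth and $\Delta_A$-harmonic in $B_I$, and $|\beta_{I,ij}|\le C/\operatorname{dist}_A(\cdot,\partial D_I)$ there. 4. If $I\subset J$ and $|J|=|I|+1$, then in $B_I$ $$|\beta_{I,ij}-\beta_{J,ij}|=|\alpha_{I,ij}-\alpha_{J,ij}|\le \frac{C}{\operatorname{dist}_A(\cdot,D_J)}.$$ 5. If $I\subsetneq J$, then in $B_I$ $$|\beta_{I,ij}-\beta_{J,ij}|=|\alpha_{I,ij}-\alpha_{J,ij}|\le \max_{\substack{I\subset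 K\subset J\\ |K|=|I|+1}}\frac{C}{\operatorname{dist}_A(\cdot,D_K)}.$$ In 4 and 5 the bound for $|\beta_{I,ij}-\beta_{J,ij}|$ holds at every point of $B_I$, and the parts involving $|\alpha_{I,ij}-\alpha_{J,ij}|$ hold at the points of $B_I$ where $\alpha_{ij}$ is finite. -/

import Mathlib

open MeasureTheory
open scoped ENNReal ContDiff Matrix

noncomputable section

namespace TaubNUT

/-- The base `ℝ^N × ℂ`, with points written `(μ₁, …, μ_N, η)`. -/
abbrev Base (N : ℕ) : Type := (Fin N → ℝ) × ℂ

/-- The coordinates `μ₀, μ₁, …, μ_N` of a point, where `μ₀ = 0` by convention. -/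
def mu {N : ℕ} (p : Base N) : Fin (N + 1) → ℝ := Fin.cons 0 p.1

/-- The map `π(z₀, …, z_N) = (½(|z₁|² - |z₀|²), …, ½(|z_N|² - |z₀|²), z₀ z₁ ⋯ z_N)`. -/
def momentMap {N : ℕ} (z : Fin (N + 1) → ℂ) : Base N :=
  (fun k => (‖z k.succ‖ ^ 2 - ‖z 0‖ ^ 2) / 2, ∏ i, z i)

/-- The stratum `D_I`: the image under `π` of the points whose vanishing coordinates are exactly
those with index in `I`. -/
def stratum {N : ℕ} (I : Finset (Fin (N + 1))) : Set (Base N) :=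
  momentMap '' {z | ∀ i, z i = 0 ↔ i ∈ I}

/-- The boundary `∂D_I`: the union of the `D_J` with `I ⊊ J`. It is empty if `I` is everything. -/
def stratumBoundary {N : ℕ} (I : Finset (Fin (N + 1))) : Set (Base N) :=
  ⋃ J : Finset (Fin (N + 1)), ⋃ _ : I ⊂ J, stratum J

/-- The norm `|(μ, η)|_A = (∑ A_ij μ_i μ_j + det A |η|²)^{1/2}`. -/
def normA {N : ℕ} (A : Matrix (Fin N) (Fin N) ℝ) (p : Base N) : ℝ :=
  Real.sqrt (p.1 ⬝ᵥ A *ᵥ p.1 + A.det * ‖p.2‖ ^ 2)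

/-- The distance `dist_A(p, S)`, with value `∞` if `S` is empty. -/
def distA {N : ℕ} (A : Matrix (Fin N) (Fin N) ℝ) (p : Base N) (S : Set (Base N)) : ℝ≥0∞ :=
  ⨅ q ∈ S, ENNReal.ofReal (normA A (p - q))

/-- The region `B_I = {p | C₀ dist_A(p, D_I) < dist_A(p, ∂D_I)}`. -/
def region {N : ℕ} (A : Matrix (Fin N) (Fin N) ℝ) (C₀ : ℝ) (I : Finset (Fin (N + 1))) :
    Set (Base N) :=
  {p | ENNReal.ofReal C₀ * distA A p (stratum I) < distA A p (stratumBoundary I)}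

/-- Second directional derivative `∂_u ∂_v f` at `p`. -/
def secondDeriv {N : ℕ} (f : Base N → ℝ) (p u v : Base N) : ℝ :=
  iteratedFDeriv ℝ 2 f p ![u, v]

/-- The Laplacian `Δ_A f = ∑ (A⁻¹)_ij ∂²f/∂μ_i∂μ_j + 4 (det A)⁻¹ ∂²f/∂η∂η̄`, where
`4 ∂²/∂η∂η̄ = ∂²/∂x² + ∂²/∂y²` for `η = x + iy`. -/
def laplacianA {N : ℕ} (A : Matrix (Fin N) (Fin N) ℝ) (f : Base N → ℝ) (p : Base N) : ℝ :=
  (∑ i, ∑ j, A⁻¹ i j * secondDeriv f p (Pi.single i 1, 0) (Pi.single j 1, 0))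
    + A.det⁻¹ * (secondDeriv f p (0, 1) (0, 1) + secondDeriv f p (0, Complex.I) (0, Complex.I))

/-- The constant `2π √(det A) / (N (N+2) α(N+2))`, where `α(N+2)` is the volume of the Euclidean
unit ball of dimension `N + 2`. -/
def greenConst {N : ℕ} (A : Matrix (Fin N) (Fin N) ℝ) : ℝ :=
  2 * Real.pi * Real.sqrt A.det /
    (N * (N + 2) * volume.real (Metric.ball (0 : EuclideanSpace ℝ (Fin (N + 2))) 1))

/-- Extension by zero of a vector with coordinates indexed by a subset of `{1, …, N}`. -/
def extendZero {N : ℕ} {P : Fin N → Prop} [DecidablePred P] (t : {k // P k} → ℝ) : Fin N → ℝ :=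
  fun k => if h : P k then t ⟨k, h⟩ else 0

/-- The function `α_{0i}` for `1 ≤ i ≤ N`, an integral over `ℝ_+^{N-1}`. -/
def alphaZero {N : ℕ} (A : Matrix (Fin N) (Fin N) ℝ) (i : Fin N) (p : Base N) : ℝ :=
  greenConst A *
    ∫ t in {t : {k : Fin N // k ≠ i} → ℝ | ∀ k, 0 < t k},
      1 / normA A (p - (extendZero t, 0)) ^ N

/-- The function `α_{ij}` for distinct `1 ≤ i, j ≤ N`, an integral over `ℝ_+^{N-1}` with variables
`t_k` (`k ≠ i, j`) and `s`; the components of `x` are `x.1 = t` and `x.2 = s`. -/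
def alphaPos {N : ℕ} (A : Matrix (Fin N) (Fin N) ℝ) (i j : Fin N) (p : Base N) : ℝ :=
  greenConst A *
    ∫ x in {x : ({k : Fin N // k ≠ i ∧ k ≠ j} → ℝ) × ℝ | (∀ k, 0 < x.1 k) ∧ 0 < x.2},
      1 / normA A (p - (extendZero x.1, 0) + x.2 • ((fun _ => 1, 0) : Base N)) ^ N

/-- The functions `α_{ij}` for `0 ≤ i, j ≤ N`, with `α_{ij} = α_{ji}` and `α_{ii} = 0`. -/
def alpha {N : ℕ} (A : Matrix (Fin N) (Fin N) ℝ) (i j : Fin (N + 1)) (p : Base N) : ℝ :=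
  if i = j then 0
  else Fin.cases (motive := fun _ => ℝ)
    (Fin.cases (motive := fun _ => ℝ) 0 (fun j' => alphaZero A j' p) j)
    (fun i' => Fin.cases (motive := fun _ => ℝ) (alphaZero A i' p)
      (fun j' => alphaPos A i' j' p) j) i

/-- The set where `α_{ij}` is finite: the complement of the closure of `D_{ij}` if `i ≠ j`, and
everything if `i = j`. -/
def finiteSet {N : ℕ} (i j : Fin (N + 1)) : Set (Base N) :=
  {p | i ≠ j → p ∉ closure (stratum {i, j})}

end TaubNUT

end

/-! Put `e_k` for the standard basis vectors and `e_0 = -(1, …, 1)`. Then the closure of `D_{ij}` is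
the cone of all `∑ t_k e_k` with `t_k ≥ 0`, `k ≠ i, j`, and every `α_{ij}`, whether or not an index
is `0`, is a constant times the potential of this cone for the kernel `|·|_A^{-N}` (`alpha_eq`).
That kernel is the harmonic one in dimension `N + 2`, and the cone has dimension `N - 1`.

For `i, j ∈ I`, let `α_{I,ij}` be the potential of the larger cone on which only the `t_k` with `k ∈
I` must be positive. This cone is invariant under translation along `e_k`, `k ∉ I`, so `α_{I,ij}`
sees only `η` and the differences `μ_a - μ_b` with `a, b ∈ I`. The remainder `β_{I,ij}` is minus the
potential of the added part, where some `t_k ≤ 0` with `k ∉ I`; likewise `β_{I,ij} - β_{J,ij}` is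
minus the potential of the part where some `k ∈ J \ I` has `t_k ≤ 0`.

Two estimates finish the proof. First, by scaling, a kernel of degree `-(n + 1)` on a subset of an
`n`-dimensional space has potential at most `C / δ` at distance `δ` (`exists_potential_bound`); off
the set the potential is smooth and harmonic, by differentiation under the integral. Second, in
`B_I` the part with `t_k ≤ 0` is at distance at least a multiple of `dist_A(p, D_{I ∪ k})`
(`IsPinched.exists_distA_insert`), because `p` is close to a point of `D_I` whose `μ_k - μ_i` is
comparatively large. The bound on `β_{I,ij}` itself is the comparison with `J` the full index set,
where the remainder vanishes. -/

noncomputable section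

namespace TaubNUT

/-! ### Potentials of homogeneous kernels: convergence, smoothness, size -/

section Kernel

variable {V E F : Type} [NormedAddCommGroup V] [NormedSpace ℝ V]
  [NormedAddCommGroup E] [NormedSpace ℝ E] [NormedAddCommGroup F] [NormedSpace ℝ F]

/-- The points at positive distance from the image of `T` under `L`. -/
def clearSet (L : V →L[ℝ] E) (T : Set V) : Set E := {p | ∃ δ > 0, ∀ t ∈ T, δ ≤ ‖p - L t‖}

theorem clearSet_anti (L : V →L[ℝ] E) {S T : Set V} (h : S ⊆ T) : clearSet L T ⊆ clearSet L S :=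
  fun _ ⟨δ, hδ, hp⟩ => ⟨δ, hδ, fun t ht => hp t (h ht)⟩

theorem le_norm_sub_of_mem_ball {L : V →L[ℝ] E} {T : Set V} {p q : E} {δ : ℝ}
    (hp : ∀ t ∈ T, δ ≤ ‖p - L t‖) (hq : q ∈ Metric.ball p (δ / 2)) : ∀ t ∈ T, δ / 2 ≤ ‖q - L t‖ := by
  intro t ht
  have h1 := hp t ht
  have h2 : ‖p - L t‖ ≤ ‖q - L t‖ + ‖q - p‖ := by
    have := norm_sub_le (q - L t) (q - p)
    rwa [show q - L t - (q - p) = p - L t by abel] at this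
  rw [Metric.mem_ball, dist_eq_norm] at hq
  linarith

theorem isOpen_clearSet (L : V →L[ℝ] E) (T : Set V) : IsOpen (clearSet L T) := by
  rw [Metric.isOpen_iff]
  rintro p ⟨δ, hδ, hp⟩
  exact ⟨δ / 2, by positivity, fun q hq => ⟨δ / 2, by positivity, le_norm_sub_of_mem_ball hp hq⟩⟩

/-- If `P` is a left inverse of `L`, the distance from `p` to `L t` grows linearly in `t`. -/
theorem norm_pow_inv_le {L : V →L[ℝ] E} {P : E →L[ℝ] V} (hP : ∀ t, P (L t) = t) {M : ℝ}
    (hM : 1 ≤ M) (hPM : ∀ x, ‖P x‖ ≤ M * ‖x‖) (m : ℕ) {p : E} {δ : ℝ} (hδ : 0 < δ) {t : V}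
    (ht : δ ≤ ‖p - L t‖) :
    (‖p - L t‖ ^ m)⁻¹ ≤ (2 * M) ^ m * ((δ + ‖P p - t‖) ^ m)⁻¹ := by
  have h1 : ‖P p - t‖ ≤ M * ‖p - L t‖ := by
    have := hPM (p - L t)
    rwa [map_sub, hP] at this
  -- Both summands are at most `M * ‖p - L t‖`, the first because `1 ≤ M`.
  have h2 : δ + ‖P p - t‖ ≤ 2 * M * ‖p - L t‖ := by nlinarith
  have h3 : 0 < ‖p - L t‖ := hδ.trans_le ht
  have h4 : 0 < δ + ‖P p - t‖ := by positivity
  rw [← div_eq_mul_inv, inv_le_iff_one_le_mul₀ (by positivity), div_mul_eq_mul_div, one_le_div (by positivity),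
    ← mul_pow]
  gcongr

section JapaneseBracket

variable [MeasurableSpace V] [BorelSpace V] [FiniteDimensional ℝ V] {μ : Measure V}
  [μ.IsAddHaarMeasure]

/-- The function `(δ + |t|)^{-m}` is integrable if `m` exceeds the dimension. -/
theorem integrable_add_norm_pow_inv {m : ℕ} (hm : Module.finrank ℝ V < m) {δ : ℝ} (hδ : 0 < δ) :
    Integrable (fun t : V => ((δ + ‖t‖) ^ m)⁻¹) μ := by
  have h1 : Integrable (fun t : V => ((1 + ‖t‖) ^ m)⁻¹) μ := by
    have := integrable_one_add_norm (E := V) (μ := μ) (r := m) (by exact_mod_cast hm)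
    refine this.congr (Filter.Eventually.of_forall fun t => ?_)
    simp only
    rw [Real.rpow_neg (by positivity), Real.rpow_natCast]
  have h2 := (h1.comp_smul (R := δ⁻¹) (by positivity)).const_mul ((δ ^ m)⁻¹)
  refine h2.congr (Filter.Eventually.of_forall fun t => ?_)
  simp only [norm_smul, norm_inv, Real.norm_of_nonneg hδ.le]
  rw [← mul_inv, ← mul_pow]
  congr 2
  field_simp

/-- The scaling behaviour of the integral of `(δ + |t|)^{-(n+1)}` in dimension `n`. -/
theorem integral_add_norm_pow_inv {m : ℕ} (hm : Module.finrank ℝ V + 1 = m) {δ : ℝ} (hδ : 0 < δ) :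
    ∫ t : V, ((δ + ‖t‖) ^ m)⁻¹ ∂μ = δ⁻¹ * ∫ t : V, ((1 + ‖t‖) ^ m)⁻¹ ∂μ := by
  have h := Measure.integral_comp_smul μ (fun t : V => ((1 + ‖t‖) ^ m)⁻¹) δ⁻¹
  have h2 : ∀ t : V, ((δ + ‖t‖) ^ m)⁻¹ = (δ ^ m)⁻¹ * ((1 + ‖δ⁻¹ • t‖) ^ m)⁻¹ := fun t => by
    simp only [norm_smul, norm_inv, Real.norm_of_nonneg hδ.le]
    rw [← mul_inv, ← mul_pow]
    congr 2
    field_simp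
  simp_rw [h2]
  rw [integral_const_mul, h, abs_of_pos (by positivity), smul_eq_mul, ← mul_assoc, ← hm]
  congr 1
  rw [inv_pow, inv_inv, pow_succ]
  field_simp

theorem integrable_bound (P : E →L[ℝ] V) {m : ℕ} (hm : Module.finrank ℝ V < m) (K : ℝ) (p : E)
    {δ : ℝ} (hδ : 0 < δ) : Integrable (fun t : V => K * ((δ + ‖P p - t‖) ^ m)⁻¹) μ :=
  ((integrable_add_norm_pow_inv hm hδ).comp_sub_left (P p)).const_mul K

end JapaneseBracket

/-- A kernel that is smooth away from the origin and positively homogeneous of degree `-m`. -/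
structure IsHomogeneousKernel (m : ℕ) (G : E → F) : Prop where
  contDiffOn : ContDiffOn ℝ ∞ G {0}ᶜ
  homogeneous : ∀ s : ℝ, 0 < s → ∀ x, x ≠ 0 → G (s • x) = (s ^ m)⁻¹ • G x

namespace IsHomogeneousKernel

variable {m : ℕ} {G : E → F}

theorem hasFDerivAt (hG : IsHomogeneousKernel m G) {x : E} (hx : x ≠ 0) :
    HasFDerivAt G (fderiv ℝ G x) x :=
  ((hG.contDiffOn.contDiffAt (isOpen_compl_singleton.mem_nhds hx)).differentiableAt
    (by simp)).hasFDerivAt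

/-- Differentiating the homogeneity relation in `x` produces one extra factor `s` on the left. Decay
therefore only improves, and every derivative of the kernel stays integrable. -/
theorem fderiv (hG : IsHomogeneousKernel m G) : IsHomogeneousKernel (m + 1) (fderiv ℝ G) where
  contDiffOn := ((contDiffOn_infty_iff_fderiv_of_isOpen isOpen_compl_singleton).1 hG.contDiffOn).2
  homogeneous s hs x hx := by
    have hsx : s • x ≠ 0 := smul_ne_zero hs.ne' hx
    have h1 : HasFDerivAt (fun y => G (s • y))
        ((_root_.fderiv ℝ G (s • x)).comp (s • ContinuousLinearMap.id ℝ E)) x :=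
      (hG.hasFDerivAt hsx).comp x ((hasFDerivAt_id x).const_smul s)
    have h2 : HasFDerivAt (fun y => G (s • y)) ((s ^ m)⁻¹ • _root_.fderiv ℝ G x) x := by
      refine ((hG.hasFDerivAt hx).const_smul _).congr_of_eventuallyEq ?_
      filter_upwards [isOpen_compl_singleton.mem_nhds hx] with y hy using hG.homogeneous s hs y hy
    have h3 := h1.unique h2
    have h4 : s • _root_.fderiv ℝ G (s • x) = (s ^ m)⁻¹ • _root_.fderiv ℝ G x := by
      rw [← h3]; ext v; simp
    rw [pow_succ, mul_inv, mul_comm, mul_smul, ← h4, smul_smul, inv_mul_cancel₀ hs.ne', one_smul]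

/-- Compactness of the unit sphere bounds `G` there, and homogeneity carries the bound to all
nonzero points. -/
theorem exists_bound [FiniteDimensional ℝ E] (hG : IsHomogeneousKernel m G) :
    ∃ K, 0 ≤ K ∧ ∀ x, x ≠ 0 → ‖G x‖ ≤ K * (‖x‖ ^ m)⁻¹ := by
  have hc : ContinuousOn G (Metric.sphere 0 1) :=
    hG.contDiffOn.continuousOn.mono fun x hx h => by simp_all
  obtain ⟨K, hK⟩ := (isCompact_sphere (0 : E) 1).exists_bound_of_continuousOn hc
  refine ⟨max K 0, le_max_right _ _, fun x hx => ?_⟩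
  have hn : 0 < ‖x‖ := norm_pos_iff.2 hx
  have hu : ‖x‖⁻¹ • x ≠ 0 := smul_ne_zero (by positivity) hx
  have h1 := hG.homogeneous ‖x‖ hn _ hu
  rw [smul_smul, mul_inv_cancel₀ hn.ne', one_smul] at h1
  rw [h1, norm_smul, norm_inv, norm_pow, norm_norm, mul_comm]
  gcongr
  exact (hK _ (by simp [norm_smul, hn.ne'])).trans (le_max_left _ _)

theorem exists_bound_comp [FiniteDimensional ℝ E] {L : V →L[ℝ] E} {P : E →L[ℝ] V}
    (hG : IsHomogeneousKernel m G) (hP : ∀ t, P (L t) = t) :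
    ∃ K, ∀ p δ, 0 < δ → ∀ t, δ ≤ ‖p - L t‖ →
      ‖G (p - L t)‖ ≤ K * ((δ + ‖P p - t‖) ^ m)⁻¹ := by
  obtain ⟨K, hK0, hK⟩ := hG.exists_bound
  have hPM : ∀ x, ‖P x‖ ≤ (‖P‖ + 1) * ‖x‖ := fun x =>
    (P.le_opNorm x).trans (by gcongr; linarith)
  refine ⟨K * (2 * (‖P‖ + 1)) ^ m, fun p δ hδ t ht => ?_⟩
  refine (hK _ (norm_pos_iff.1 (hδ.trans_le ht))).trans ?_
  rw [mul_assoc]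
  gcongr
  exact norm_pow_inv_le hP (by linarith [norm_nonneg P]) hPM m hδ ht

variable [MeasurableSpace V] {μ : Measure V}

theorem aestronglyMeasurable (hG : IsHomogeneousKernel m G) [BorelSpace V] [FiniteDimensional ℝ V]
    {L : V →L[ℝ] E} {T : Set V} (hT : MeasurableSet T) {p : E} (hp : p ∈ clearSet L T) :
    AEStronglyMeasurable (fun t => G (p - L t)) (μ.restrict T) := by
  obtain ⟨δ, hδ, hp⟩ := hp
  refine ContinuousOn.aestronglyMeasurable (hG.contDiffOn.continuousOn.comp (by fun_prop) ?_) hT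
  intro t ht h
  have := hp t ht
  simp only [Set.mem_singleton_iff] at h
  rw [h, norm_zero] at this
  linarith

section Potential


variable [BorelSpace V] [FiniteDimensional ℝ V] [μ.IsAddHaarMeasure]
  [FiniteDimensional ℝ E] {L : V →L[ℝ] E} {P : E →L[ℝ] V} {T : Set V}

theorem integrableOn (hG : IsHomogeneousKernel m G) (hm : Module.finrank ℝ V < m)
    (hP : ∀ t, P (L t) = t) (hT : MeasurableSet T) {p : E} (hp : p ∈ clearSet L T) :
    IntegrableOn (fun t => G (p - L t)) T μ := by
  obtain ⟨K, hK⟩ := hG.exists_bound_comp hP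
  have hm' := hG.aestronglyMeasurable (μ := μ) hT hp
  obtain ⟨δ, hδ, hp⟩ := hp
  exact (integrable_bound P hm K p hδ).restrict.mono' hm'
    ((ae_restrict_iff' hT).2 (.of_forall fun t ht => hK p δ hδ t (hp t ht)))

/-- Differentiation under the integral sign. -/
theorem hasFDerivAt_integral (hG : IsHomogeneousKernel m G) (hm : Module.finrank ℝ V < m)
    (hP : ∀ t, P (L t) = t) (hT : MeasurableSet T) {p : E} (hp : p ∈ clearSet L T) :
    HasFDerivAt (fun q => ∫ t in T, G (q - L t) ∂μ)
      (∫ t in T, _root_.fderiv ℝ G (p - L t) ∂μ) p := by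
  obtain ⟨K, hK⟩ := hG.fderiv.exists_bound_comp hP
  have hp' := hp
  obtain ⟨δ, hδ, hpδ⟩ := hp
  have hball : ∀ t ∈ T, ∀ q ∈ Metric.ball p (δ / 2), δ / 2 ≤ ‖q - L t‖ :=
    fun t ht q hq => le_norm_sub_of_mem_ball hpδ hq t ht
  -- The dominating function must not depend on `q`. Moving `q` costs `δ / 2` in the distance to the
  -- set and at most `δ / 4` in `P q`, which leaves `δ / 4 + ‖P p - t‖`.
  obtain ⟨ρ, hρ0, hρδ, hρ⟩ : ∃ ρ > 0, ρ ≤ δ / 2 ∧ ∀ q ∈ Metric.ball p ρ, ‖P q - P p‖ ≤ δ / 4 := by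
    have := Metric.continuousAt_iff.1 (P.continuous.continuousAt (x := p)) (δ / 4) (by positivity)
    obtain ⟨ρ, hρ0, hρ⟩ := this
    refine ⟨min ρ (δ / 2), by positivity, min_le_right _ _, fun q hq => ?_⟩
    have := hρ (x := q) ((Metric.mem_ball.1 hq).trans_le (min_le_left _ _))
    rw [dist_eq_norm] at this
    exact this.le
  -- The sign of `K` is not part of `exists_bound_comp`; the bound at any point of `T` forces it.
  have hK0 : ∀ t ∈ T, 0 ≤ K := fun t ht => by
    have h := (norm_nonneg _).trans (hK p δ hδ t (hpδ t ht))
    exact nonneg_of_mul_nonneg_left h (by positivity)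
  refine hasFDerivAt_integral_of_dominated_of_fderiv_le
    (bound := fun t => K * ((δ / 4 + ‖P p - t‖) ^ (m + 1))⁻¹)
    (F' := fun q t => _root_.fderiv ℝ G (q - L t))
    (Metric.ball_mem_nhds p hρ0) ?_ (hG.integrableOn hm hP hT hp')
    (hG.fderiv.aestronglyMeasurable hT hp') ?_
    (integrable_bound P (by omega) K p (by positivity)).restrict ?_
  · filter_upwards [(isOpen_clearSet L T).mem_nhds hp'] with q hq
    exact hG.aestronglyMeasurable hT hq
  · refine (ae_restrict_iff' hT).2 (.of_forall fun t ht q hq => ?_)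
    refine (hK q (δ / 2) (by positivity) t
      (hball t ht q (Metric.ball_subset_ball hρδ hq))).trans ?_
    have := hK0 t ht
    have h1 : ‖P p - t‖ ≤ ‖P q - t‖ + ‖P q - P p‖ := by
      have := norm_sub_le (P q - t) (P q - P p)
      rwa [show P q - t - (P q - P p) = P p - t by abel] at this
    have h2 := hρ q hq
    gcongr ?_ * (?_ ^ _)⁻¹
    linarith
  · refine (ae_restrict_iff' hT).2 (.of_forall fun t ht q hq => ?_)
    have hne : q - L t ≠ 0 := norm_pos_iff.1 (lt_of_lt_of_le (by positivity)
      (hball t ht q (Metric.ball_subset_ball hρδ hq)))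
    exact (hG.hasFDerivAt hne).comp q ((hasFDerivAt_id q).sub_const (L t))

end Potential

end IsHomogeneousKernel

variable [MeasurableSpace V] [BorelSpace V] [FiniteDimensional ℝ V] {μ : Measure V}
  [μ.IsAddHaarMeasure]

/-- The potential of a homogeneous kernel is smooth off its support. -/
theorem contDiffOn_potential [FiniteDimensional ℝ E] {L : V →L[ℝ] E} {P : E →L[ℝ] V} {T : Set V}
    (hP : ∀ t, P (L t) = t) (hT : MeasurableSet T) (n : ℕ) :
    ∀ {F : Type} [NormedAddCommGroup F] [NormedSpace ℝ F] {m : ℕ} {G : E → F},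
      IsHomogeneousKernel m G → Module.finrank ℝ V < m →
      ContDiffOn ℝ n (fun q => ∫ t in T, G (q - L t) ∂μ) (clearSet L T) := by
  -- The target `F`, the degree and the kernel vary in the induction, since the derivative of the
  -- potential is the potential of `fderiv ℝ G`.
  induction n with
  | zero =>
    intro F _ _ m G hG hm
    rw [Nat.cast_zero, contDiffOn_zero]
    exact fun p hp => (hG.hasFDerivAt_integral hm hP hT hp).continuousAt.continuousWithinAt
  | succ n ih =>
    intro F _ _ m G hG hm
    rw [Nat.cast_succ, contDiffOn_succ_iff_fderiv_of_isOpen (isOpen_clearSet L T)]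
    refine ⟨fun p hp => (hG.hasFDerivAt_integral hm hP hT hp).differentiableAt.differentiableWithinAt,
      fun h => by simp at h, ?_⟩
    exact (ih hG.fderiv (by omega)).congr fun p hp => (hG.hasFDerivAt_integral hm hP hT hp).fderiv

/-- The second derivative of the potential of a homogeneous kernel. -/
theorem fderiv_fderiv_potential [FiniteDimensional ℝ E] {L : V →L[ℝ] E} {P : E →L[ℝ] V} {T : Set V}
    (hP : ∀ t, P (L t) = t) (hT : MeasurableSet T) {m : ℕ} {G : E → F}
    (hG : IsHomogeneousKernel m G) (hm : Module.finrank ℝ V < m) {p : E} (hp : p ∈ clearSet L T) :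
    fderiv ℝ (fderiv ℝ (fun q => ∫ t in T, G (q - L t) ∂μ)) p =
      ∫ t in T, fderiv ℝ (fderiv ℝ G) (p - L t) ∂μ := by
  have h1 : fderiv ℝ (fun q => ∫ t in T, G (q - L t) ∂μ) =ᶠ[nhds p]
      fun q => ∫ t in T, fderiv ℝ G (q - L t) ∂μ := by
    filter_upwards [(isOpen_clearSet L T).mem_nhds hp] with q hq
    exact (hG.hasFDerivAt_integral hm hP hT hq).fderiv
  rw [h1.fderiv_eq, (hG.fderiv.hasFDerivAt_integral (by omega) hP hT hp).fderiv]

/-- The potential of a kernel bounded by `K |x|^{-(n+1)}`, with density on an `n`-dimensional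
set, is bounded by the inverse distance to its support. -/
theorem exists_potential_bound {m : ℕ} (hm : Module.finrank ℝ V + 1 = m) {M : ℝ} (hM : 1 ≤ M)
    {K : ℝ} (hK : 0 ≤ K) :
    ∃ C, 0 ≤ C ∧ ∀ (L : V →L[ℝ] E) (P : E →L[ℝ] V), (∀ t, P (L t) = t) →
      (∀ x, ‖P x‖ ≤ M * ‖x‖) → ∀ G : E → F, (∀ x, x ≠ 0 → ‖G x‖ ≤ K * (‖x‖ ^ m)⁻¹) →
      ∀ (T : Set V), MeasurableSet T → ∀ p δ, 0 < δ → (∀ t ∈ T, δ ≤ ‖p - L t‖) →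
        ‖∫ t in T, G (p - L t) ∂μ‖ ≤ C / δ := by
  refine ⟨K * (2 * M) ^ m * ∫ t : V, ((1 + ‖t‖) ^ m)⁻¹ ∂μ, ?_, ?_⟩
  · have : 0 ≤ ∫ t : V, ((1 + ‖t‖) ^ m)⁻¹ ∂μ := integral_nonneg fun t => by positivity
    positivity
  intro L P hP hPM G hG T hT p δ hδ hp
  have hint := integrable_bound (μ := μ) P (m := m) (by omega) (K * (2 * M) ^ m) p hδ
  calc ‖∫ t in T, G (p - L t) ∂μ‖
      ≤ ∫ t in T, K * (2 * M) ^ m * ((δ + ‖P p - t‖) ^ m)⁻¹ ∂μ := by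
        refine norm_integral_le_of_norm_le hint.restrict
          ((ae_restrict_iff' hT).2 (.of_forall fun t ht => ?_))
        have hd := hp t ht
        refine (hG _ (norm_pos_iff.1 (hδ.trans_le hd))).trans ?_
        rw [mul_assoc]
        gcongr
        exact norm_pow_inv_le hP hM hPM m hδ hd
    _ ≤ ∫ t, K * (2 * M) ^ m * ((δ + ‖P p - t‖) ^ m)⁻¹ ∂μ :=
        setIntegral_le_integral hint (.of_forall fun t => by simp only [Pi.zero_apply]; positivity)
    _ = K * (2 * M) ^ m * (∫ t : V, ((1 + ‖t‖) ^ m)⁻¹ ∂μ) / δ := by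
        rw [integral_const_mul, integral_sub_left_eq_self (fun t => ((δ + ‖t‖) ^ m)⁻¹) μ (P p),
          integral_add_norm_pow_inv hm hδ]
        ring

end Kernel

/-! ### Comparison of `|·|_A` with the sup norm, uniformly in `A` -/

section Norm

variable {N : ℕ} {A : Matrix (Fin N) (Fin N) ℝ} {lam Lam : ℝ}

/-- The matrix `A` is symmetric with all eigenvalues in `[lam, Lam]`. -/
structure IsPinched (A : Matrix (Fin N) (Fin N) ℝ) (lam Lam : ℝ) : Prop where
  isSymm : A.IsSymm
  pos : 0 < lam
  bounds : ∀ x : Fin N → ℝ, lam * (x ⬝ᵥ x) ≤ x ⬝ᵥ A *ᵥ x ∧ x ⬝ᵥ A *ᵥ x ≤ Lam * (x ⬝ᵥ x)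

/-- Testing the quadratic form on eigenvectors pins each eigenvalue, and the determinant is their
product. -/
theorem IsPinched.det_bounds (hA : IsPinched A lam Lam) :
    lam ^ N ≤ A.det ∧ A.det ≤ Lam ^ N := by
  have hH : A.IsHermitian := by
    rw [Matrix.IsHermitian, Matrix.conjTranspose_eq_transpose_of_trivial]
    exact hA.isSymm
  have hev : ∀ i, lam ≤ hH.eigenvalues i ∧ hH.eigenvalues i ≤ Lam := fun i => by
    have h0 : (hH.eigenvectorBasis i).ofLp ≠ 0 := fun h =>
      hH.eigenvectorBasis.orthonormal.ne_zero i (by ext k; exact congrFun h k)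
    have h1 := hH.mulVec_eigenvectorBasis i
    have h2 := hA.bounds (hH.eigenvectorBasis i).ofLp
    rw [h1, dotProduct_smul, smul_eq_mul] at h2
    have h3 : 0 < (hH.eigenvectorBasis i).ofLp ⬝ᵥ (hH.eigenvectorBasis i).ofLp :=
      lt_of_le_of_ne (Finset.sum_nonneg fun k _ => mul_self_nonneg _)
        fun h => h0 (dotProduct_self_eq_zero.1 h.symm)
    exact ⟨le_of_mul_le_mul_right h2.1 h3, le_of_mul_le_mul_right h2.2 h3⟩
  have hdet := hH.det_eq_prod_eigenvalues
  simp only [RCLike.ofReal_real_eq_id, id_eq] at hdet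
  have hl : lam ^ N = ∏ _i : Fin N, lam := by simp
  have hL : Lam ^ N = ∏ _i : Fin N, Lam := by simp
  rw [hdet, hl, hL]
  exact ⟨Finset.prod_le_prod (fun _ _ => hA.pos.le) fun i _ => (hev i).1,
    Finset.prod_le_prod (fun i _ => hA.pos.le.trans (hev i).1) fun i _ => (hev i).2⟩

theorem IsPinched.det_pos (hA : IsPinched A lam Lam) : 0 < A.det :=
  (pow_pos hA.pos N).trans_le hA.det_bounds.1

theorem IsPinched.isUnit_det (hA : IsPinched A lam Lam) : IsUnit A.det :=
  hA.det_pos.ne'.isUnit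

/-- The constant in the lower bound of `|·|_A` by the sup norm. -/
def lowerConst (N : ℕ) (lam : ℝ) : ℝ := Real.sqrt (min lam (lam ^ N))

/-- The constant in the upper bound of `|·|_A` by the sup norm. -/
def upperConst (N : ℕ) (Lam : ℝ) : ℝ := Real.sqrt (Lam * N + Lam ^ N)

theorem lowerConst_pos (hlam : 0 < lam) : 0 < lowerConst N lam :=
  Real.sqrt_pos.2 (lt_min hlam (pow_pos hlam N))

theorem upperConst_pos (hLam : 0 < Lam) : 0 < upperConst N Lam :=
  Real.sqrt_pos.2 (by positivity)

theorem IsPinched.form_nonneg (hA : IsPinched A lam Lam) (x : Fin N → ℝ) : 0 ≤ x ⬝ᵥ A *ᵥ x :=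
  (mul_nonneg hA.pos.le (Finset.sum_nonneg fun k _ => mul_self_nonneg (x k))).trans
    (hA.bounds x).1

theorem IsPinched.normA_sq (hA : IsPinched A lam Lam) (p : Base N) :
    normA A p ^ 2 = p.1 ⬝ᵥ A *ᵥ p.1 + A.det * ‖p.2‖ ^ 2 :=
  Real.sq_sqrt (add_nonneg (hA.form_nonneg _) (mul_nonneg hA.det_pos.le (sq_nonneg _)))

theorem IsPinched.lower_le_normA (hA : IsPinched A lam Lam) (p : Base N) :
    lowerConst N lam * ‖p‖ ≤ normA A p := by
  refine Real.le_sqrt_of_sq_le ?_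
  have hmin : 0 < min lam (lam ^ N) := lt_min hA.pos (pow_pos hA.pos N)
  rw [mul_pow, lowerConst, Real.sq_sqrt hmin.le]
  have hnn : 0 ≤ p.1 ⬝ᵥ p.1 := Finset.sum_nonneg fun k _ => mul_self_nonneg (p.1 k)
  have h1 : ‖p.1‖ ^ 2 ≤ p.1 ⬝ᵥ p.1 := by
    have : ‖p.1‖ ≤ Real.sqrt (p.1 ⬝ᵥ p.1) := by
      refine (pi_norm_le_iff_of_nonneg (Real.sqrt_nonneg _)).2 fun k => Real.le_sqrt_of_sq_le ?_
      rw [Real.norm_eq_abs, sq_abs, sq]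
      exact Finset.single_le_sum (f := fun k => p.1 k * p.1 k) (fun k _ => mul_self_nonneg _)
        (Finset.mem_univ k)
    calc ‖p.1‖ ^ 2 ≤ Real.sqrt (p.1 ⬝ᵥ p.1) ^ 2 := by gcongr
      _ = _ := Real.sq_sqrt hnn
  have h2 := (hA.bounds p.1).1
  have h3 : ‖p‖ ^ 2 ≤ ‖p.1‖ ^ 2 + ‖p.2‖ ^ 2 := by
    rw [Prod.norm_def]
    rcases max_choice ‖p.1‖ ‖p.2‖ with h | h <;> rw [h] <;>
      linarith [sq_nonneg ‖p.1‖, sq_nonneg ‖p.2‖]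
  have h4 : min lam (lam ^ N) * ‖p.1‖ ^ 2 ≤ lam * (p.1 ⬝ᵥ p.1) := by
    exact mul_le_mul (min_le_left _ _) h1 (sq_nonneg _) hA.pos.le
  have h5 : min lam (lam ^ N) * ‖p.2‖ ^ 2 ≤ A.det * ‖p.2‖ ^ 2 := by
    gcongr
    exact (min_le_right _ _).trans hA.det_bounds.1
  nlinarith

theorem IsPinched.normA_le_upper (hA : IsPinched A lam Lam) (hLam : 0 < Lam) (p : Base N) :
    normA A p ≤ upperConst N Lam * ‖p‖ := by
  refine Real.sqrt_le_iff.2 ⟨mul_nonneg (Real.sqrt_nonneg _) (norm_nonneg _), ?_⟩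
  rw [mul_pow, upperConst, Real.sq_sqrt (by positivity), add_mul]
  refine add_le_add ((hA.bounds p.1).2.trans ?_) ?_
  · rw [mul_assoc]
    gcongr
    calc p.1 ⬝ᵥ p.1 ≤ ∑ _k : Fin N, ‖p‖ ^ 2 := by
          refine Finset.sum_le_sum fun k _ => ?_
          have h1 : ‖p.1 k‖ ≤ ‖p‖ := (norm_le_pi_norm _ k).trans (norm_fst_le p)
          rw [← sq, ← sq_abs]
          exact pow_le_pow_left₀ (abs_nonneg _) h1 2
      _ = N * ‖p‖ ^ 2 := by simp
  · gcongr
    · exact hA.det_bounds.2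
    · exact norm_snd_le p

theorem IsPinched.normA_pos (hA : IsPinched A lam Lam) {p : Base N} (hp : p ≠ 0) :
    0 < normA A p :=
  (mul_pos (lowerConst_pos hA.pos) (norm_pos_iff.2 hp)).trans_le (hA.lower_le_normA p)

theorem normA_smul (s : ℝ) (p : Base N) : normA A (s • p) = |s| * normA A p := by
  rw [normA, normA, ← Real.sqrt_sq_eq_abs, ← Real.sqrt_mul (sq_nonneg s)]
  congr 1
  simp only [Prod.smul_fst, Prod.smul_snd, Matrix.mulVec_smul, dotProduct_smul, smul_dotProduct,
    smul_eq_mul, norm_smul, mul_pow, Real.norm_eq_abs, sq_abs]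
  ring

theorem greenConst_nonneg : 0 ≤ greenConst A := by
  unfold greenConst
  positivity

/-- The bound for the constant in front of the potentials. -/
def greenBound (N : ℕ) (Lam : ℝ) : ℝ :=
  2 * Real.pi * Real.sqrt (Lam ^ N) /
    (N * (N + 2) * volume.real (Metric.ball (0 : EuclideanSpace ℝ (Fin (N + 2))) 1))

theorem greenBound_nonneg : 0 ≤ greenBound N Lam := by
  unfold greenBound
  positivity

theorem IsPinched.greenConst_le (hA : IsPinched A lam Lam) : greenConst A ≤ greenBound N Lam := by
  unfold greenConst greenBound
  gcongr
  exact hA.det_bounds.2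

end Norm

/-! ### Harmonicity of `|·|_A^{-N}` -/

section Harmonic

variable {N : ℕ} {A : Matrix (Fin N) (Fin N) ℝ} {lam Lam : ℝ}

/-- The bilinear form whose quadratic form is `|·|_A²`. -/
def formA (A : Matrix (Fin N) (Fin N) ℝ) : Base N →L[ℝ] Base N →L[ℝ] ℝ :=
  LinearMap.toContinuousLinearMap <| LinearMap.toContinuousLinearMap.toLinearMap ∘ₗ
    LinearMap.mk₂ ℝ (fun p q : Base N => q.1 ⬝ᵥ A *ᵥ p.1 + A.det * (p.2.re * q.2.re + p.2.im * q.2.im))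
      (fun _ _ _ => by
        simp only [Prod.fst_add, Prod.snd_add, Complex.add_re, Complex.add_im, Matrix.mulVec_add, dotProduct_add]
        ring)
      (fun _ _ _ => by
        simp only [Prod.smul_fst, Prod.smul_snd, Complex.smul_re, Complex.smul_im,
          Matrix.mulVec_smul, dotProduct_smul, smul_eq_mul]
        ring)
      (fun _ _ _ => by
        simp only [Prod.fst_add, Prod.snd_add, Complex.add_re, Complex.add_im, add_dotProduct]
        ring)
      (fun _ _ _ => by
        simp only [Prod.smul_fst, Prod.smul_snd, Complex.smul_re, Complex.smul_im,
          smul_dotProduct, smul_eq_mul]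
        ring)

theorem formA_apply (p q : Base N) :
    formA A p q = q.1 ⬝ᵥ A *ᵥ p.1 + A.det * (p.2.re * q.2.re + p.2.im * q.2.im) := rfl

theorem IsPinched.formA_comm (hA : IsPinched A lam Lam) (p q : Base N) :
    formA A p q = formA A q p := by
  rw [formA_apply, formA_apply, Matrix.dotProduct_mulVec, ← Matrix.mulVec_transpose,
    hA.isSymm.eq, dotProduct_comm]
  ring

theorem IsPinched.formA_self (hA : IsPinched A lam Lam) (p : Base N) :
    formA A p p = normA A p ^ 2 := by
  rw [formA_apply, hA.normA_sq, Complex.sq_norm, Complex.normSq_apply]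

theorem normA_eq_sqrt_formA (p : Base N) : normA A p = Real.sqrt (formA A p p) := by
  rw [formA_apply, normA, Complex.sq_norm, Complex.normSq_apply]

theorem IsPinched.hasFDerivAt_normA (hA : IsPinched A lam Lam) {p : Base N} (hp : p ≠ 0) :
    HasFDerivAt (normA A) ((normA A p)⁻¹ • formA A p) p := by
  have h1 : HasFDerivAt (fun q => formA A q q) ((2 : ℝ) • formA A p) p := by
    refine ((formA A).hasFDerivAt.clm_apply (hasFDerivAt_id p)).congr_fderiv ?_
    ext v <;> simp [hA.formA_comm _ p] <;> ring
  have hpos := hA.normA_pos hp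
  have h2 := h1.sqrt (by rw [hA.formA_self]; positivity)
  rw [show normA A = fun q => Real.sqrt (formA A q q) from funext normA_eq_sqrt_formA]
  refine h2.congr_fderiv ?_
  rw [smul_smul]
  congr 1
  field_simp

theorem IsPinched.hasFDerivAt_normA_pow_inv (hA : IsPinched A lam Lam) (m : ℕ) {p : Base N}
    (hp : p ≠ 0) :
    HasFDerivAt (fun q => (normA A q ^ m)⁻¹) ((-m * (normA A p ^ (m + 2))⁻¹) • formA A p) p := by
  have hpos := hA.normA_pos hp
  have h := (hasDerivAt_inv (pow_pos hpos m).ne').comp_hasFDerivAt p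
    ((hA.hasFDerivAt_normA hp).pow m)
  refine h.congr_fderiv ?_
  rw [smul_smul, smul_smul]
  congr 1
  rcases m with _ | m
  · simp
  · simp only [nsmul_eq_mul, Nat.add_sub_cancel]
    field_simp
    ring

theorem IsPinched.fderiv_fderiv_normA_pow_inv (hA : IsPinched A lam Lam) (m : ℕ) {p : Base N}
    (hp : p ≠ 0) (u v : Base N) :
    fderiv ℝ (fderiv ℝ (fun q => (normA A q ^ m)⁻¹)) p u v =
      m * (m + 2) * (normA A p ^ (m + 4))⁻¹ * (formA A p u * formA A p v) -
        m * (normA A p ^ (m + 2))⁻¹ * formA A u v := by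
  have h1 : fderiv ℝ (fun q => (normA A q ^ m)⁻¹) =ᶠ[nhds p]
      fun q => (-m * (normA A q ^ (m + 2))⁻¹) • formA A q := by
    filter_upwards [isOpen_compl_singleton.mem_nhds hp] with q hq
    exact (hA.hasFDerivAt_normA_pow_inv m hq).fderiv
  have h2 := ((hA.hasFDerivAt_normA_pow_inv (m + 2) hp).const_mul (-m : ℝ)).fun_smul
    (formA A).hasFDerivAt
  rw [h1.fderiv_eq, h2.fderiv]
  simp only [add_apply, smul_apply,
    ContinuousLinearMap.smulRight_apply, smul_eq_mul]
  push_cast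
  ring

theorem IsPinched.contDiffOn_normA_pow_inv (hA : IsPinched A lam Lam) (m : ℕ) :
    ContDiffOn ℝ ∞ (fun q => (normA A q ^ m)⁻¹) {0}ᶜ := by
  intro p hp
  have hpos := hA.normA_pos hp
  have h1 : ContDiffAt ℝ ∞ (fun q => formA A q q) p :=
    ((formA A).contDiff.clm_apply contDiff_id).contDiffAt
  have h2 : ContDiffAt ℝ ∞ (normA A) p := by
    rw [show normA A = fun q => Real.sqrt (formA A q q) from funext normA_eq_sqrt_formA]
    exact h1.sqrt (by rw [hA.formA_self]; positivity)
  exact ((h2.pow m).inv (by positivity)).contDiffWithinAt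

theorem IsPinched.isHomogeneousKernel (hA : IsPinched A lam Lam) (m : ℕ) :
    IsHomogeneousKernel m (fun q => (normA A q ^ m)⁻¹) where
  contDiffOn := hA.contDiffOn_normA_pow_inv m
  homogeneous s hs x _ := by
    simp only [normA_smul, abs_of_pos hs, mul_pow, mul_inv, smul_eq_mul]

/-- The trace of a bilinear form with respect to the metric `A ⊕ det A`. -/
def traceA (A : Matrix (Fin N) (Fin N) ℝ) (B : Base N → Base N → ℝ) : ℝ :=
  (∑ i, ∑ j, A⁻¹ i j * B (Pi.single i 1, 0) (Pi.single j 1, 0))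
    + A.det⁻¹ * (B (0, 1) (0, 1) + B (0, Complex.I) (0, Complex.I))

theorem laplacianA_eq (f : Base N → ℝ) (p : Base N) :
    laplacianA A f p = traceA A (fun u v => fderiv ℝ (fderiv ℝ f) p u v) := by
  simp [laplacianA, traceA, secondDeriv, iteratedFDeriv_two_apply]

theorem traceA_linear (a b : ℝ) (B B' : Base N → Base N → ℝ) :
    traceA A (fun u v => a * B u v - b * B' u v) = a * traceA A B - b * traceA A B' := by
  simp only [traceA, mul_add, mul_sub, Finset.mul_sum, Finset.sum_sub_distrib]
  simp only [mul_left_comm]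
  ring

theorem IsPinched.traceA_formA (hA : IsPinched A lam Lam) :
    traceA A (fun u v => formA A u v) = N + 2 := by
  have h1 : ∑ i, ∑ j, A⁻¹ i j * A j i = N := by
    have : (A⁻¹ * A).trace = N := by rw [Matrix.nonsing_inv_mul _ hA.isUnit_det]; simp
    simpa [Matrix.trace, Matrix.mul_apply] using this
  have := hA.det_pos.ne'
  simp only [traceA, formA_apply]
  simp [h1]
  field_simp
  ring

/-- The matrix `A⁻¹ ⊕ (det A)⁻¹` is the dual metric, so the trace is the squared dual norm of the
covector `formA A p`, which is the squared norm of `p`. -/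
theorem IsPinched.traceA_formA_mul (hA : IsPinched A lam Lam) (p : Base N) :
    traceA A (fun u v => formA A p u * formA A p v) = normA A p ^ 2 := by
  have h1 : ∑ i, ∑ j, A⁻¹ i j * ((A *ᵥ p.1) i * (A *ᵥ p.1) j) = p.1 ⬝ᵥ A *ᵥ p.1 := by
    have h : (A *ᵥ p.1) ⬝ᵥ (A⁻¹ *ᵥ (A *ᵥ p.1)) = p.1 ⬝ᵥ A *ᵥ p.1 := by
      rw [Matrix.mulVec_mulVec, Matrix.nonsing_inv_mul _ hA.isUnit_det, Matrix.one_mulVec,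
        dotProduct_comm]
    rw [← h]
    generalize A *ᵥ p.1 = w
    simp only [dotProduct, Matrix.mulVec, Finset.mul_sum]
    exact Finset.sum_congr rfl fun i _ => Finset.sum_congr rfl fun j _ => by ring
  have := hA.det_pos.ne'
  rw [hA.normA_sq, Complex.sq_norm, Complex.normSq_apply, ← h1]
  simp only [traceA, formA_apply]
  simp
  field_simp

/-- The function `|·|_A^{-N}` is harmonic away from the origin. -/
theorem IsPinched.traceA_fderiv_kernel (hA : IsPinched A lam Lam) {p : Base N} (hp : p ≠ 0) :
    traceA A (fun u v => fderiv ℝ (fderiv ℝ (fun q => (normA A q ^ N)⁻¹)) p u v) = 0 := by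
  simp_rw [hA.fderiv_fderiv_normA_pow_inv N hp]
  -- The two terms are `N (N + 2) |p|^{-(N+4)} |p|²` and `N |p|^{-(N+2)} (N + 2)`; they cancel
  -- because the exponent is the dimension minus two.
  rw [traceA_linear, hA.traceA_formA, hA.traceA_formA_mul]
  have := hA.normA_pos hp
  field_simp
  ring

end Harmonic

/-! ### Strata as explicit cones, and the geometry of `B_I` -/

section Strata

variable {N : ℕ} {A : Matrix (Fin N) (Fin N) ℝ} {lam Lam : ℝ}

theorem mu_zero (p : Base N) : mu p 0 = 0 := rfl

theorem mu_succ (p : Base N) (k : Fin N) : mu p k.succ = p.1 k := rfl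

theorem mu_sub (p q : Base N) (a : Fin (N + 1)) : mu (p - q) a = mu p a - mu q a := by
  cases a using Fin.cases <;> simp [mu]

theorem mu_smul (s : ℝ) (p : Base N) (a : Fin (N + 1)) : mu (s • p) a = s * mu p a := by
  cases a using Fin.cases <;> simp [mu]

theorem abs_mu_le (p : Base N) (a : Fin (N + 1)) : |mu p a| ≤ ‖p‖ := by
  cases a using Fin.cases with
  | zero => simp [mu_zero]
  | succ k => exact (norm_le_pi_norm p.1 k).trans (norm_fst_le p)

theorem abs_mu_sub_mu_le (p : Base N) (a b : Fin (N + 1)) : |mu p a - mu p b| ≤ 2 * ‖p‖ := by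
  have := abs_sub (mu p a) (mu p b)
  linarith [abs_mu_le p a, abs_mu_le p b]

/-- The point `∑ m_k e_k` of the base, where `e_0 = -(1, …, 1)`. -/
def ray : (Fin (N + 1) → ℝ) →ₗ[ℝ] Base N where
  toFun m := (fun k => m k.succ - m 0, 0)
  map_add' m m' := by ext <;> simp; ring
  map_smul' s m := by ext <;> simp; ring

theorem mu_ray (m : Fin (N + 1) → ℝ) (a : Fin (N + 1)) : mu (ray m) a = m a - m 0 := by
  cases a using Fin.cases <;> simp [mu, ray]

theorem norm_ray_single_le (k : Fin (N + 1)) (τ : ℝ) : ‖(ray (Pi.single k τ) : Base N)‖ ≤ |τ| := by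
  refine norm_prod_le_iff.2 ⟨(pi_norm_le_iff_of_nonneg (abs_nonneg _)).2 fun l => ?_, by simp [ray]⟩
  cases k using Fin.cases with
  | zero => simp [ray]
  | succ k =>
    by_cases h : l = k
    · subst h; simp [ray]
    · simp [ray, h]

/-- If `z a = 0`, then `μ_k - μ_a = ½ |z_k|²`. So `I` is the set of indices where `μ` attains its
minimum; conversely the real numbers `√(2 (μ_k - μ_a))` give a preimage. -/
theorem mem_stratum_iff {I : Finset (Fin (N + 1))} {a : Fin (N + 1)} (ha : a ∈ I) (q : Base N) :
    q ∈ stratum I ↔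
      q.2 = 0 ∧ (∀ k ∈ I, mu q k = mu q a) ∧ ∀ k, k ∉ I → mu q a < mu q k := by
  constructor
  · rintro ⟨z, hz, rfl⟩
    have hmu : ∀ k, mu (momentMap z) k = (‖z k‖ ^ 2 - ‖z 0‖ ^ 2) / 2 := fun k => by
      cases k using Fin.cases <;> simp [mu, momentMap]
    have hza : z a = 0 := (hz a).2 ha
    refine ⟨Finset.prod_eq_zero (Finset.mem_univ a) hza, fun k hk => ?_, fun k hk => ?_⟩
    · rw [hmu, hmu, hza, (hz k).2 hk]
    · have : 0 < ‖z k‖ ^ 2 := by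
        have : z k ≠ 0 := fun h => hk ((hz k).1 h)
        positivity
      rw [hmu, hmu, hza, norm_zero]
      linarith
  · rintro ⟨h0, hI, hIc⟩
    have hnn : ∀ k, 0 ≤ mu q k - mu q a := fun k => by
      by_cases hk : k ∈ I
      · rw [hI k hk, sub_self]
      · exact sub_nonneg.2 (hIc k hk).le
    have hz : ∀ k, ((Real.sqrt (2 * (mu q k - mu q a)) : ℝ) : ℂ) = 0 ↔ k ∈ I := fun k => by
      rw [Complex.ofReal_eq_zero, Real.sqrt_eq_zero (by linarith [hnn k])]
      refine ⟨fun h => ?_, fun h => by rw [hI k h]; ring⟩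
      by_contra hk
      linarith [hIc k hk]
    refine ⟨fun k => (Real.sqrt (2 * (mu q k - mu q a)) : ℝ), hz, Prod.ext (funext fun k => ?_) ?_⟩
    · simp only [momentMap, Complex.norm_real, Real.norm_eq_abs, sq_abs]
      rw [Real.sq_sqrt (by linarith [hnn k.succ]), Real.sq_sqrt (by linarith [hnn 0]), mu_zero,
        mu_succ]
      ring
    · rw [h0]
      exact Finset.prod_eq_zero (Finset.mem_univ a) ((hz a).2 ha)

theorem distA_le {S : Set (Base N)} (p : Base N) {q : Base N} (hq : q ∈ S) :
    distA A p S ≤ ENNReal.ofReal (normA A (p - q)) :=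
  iInf₂_le q hq

theorem stratum_subset_boundary {I J : Finset (Fin (N + 1))} (h : I ⊂ J) :
    (stratum J : Set (Base N)) ⊆ stratumBoundary I :=
  Set.subset_iUnion₂_of_subset J h subset_rfl

theorem distA_boundary_le {I J : Finset (Fin (N + 1))} (h : I ⊂ J) (p : Base N) :
    distA A p (stratumBoundary I) ≤ distA A p (stratum J) :=
  biInf_mono (stratum_subset_boundary h)

/-- Strictness of the inequality defining the region passes from the infimum to a near-minimizer, so
no closest point of `D_I` is needed. -/
theorem exists_of_mem_region {C₀ : ℝ} (hC₀ : 0 < C₀) {I : Finset (Fin (N + 1))} {p : Base N}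
    (hp : p ∈ region A C₀ I) :
    ∃ q ∈ stratum I, ∀ s ∈ stratumBoundary I, C₀ * normA A (p - q) < normA A (p - s) := by
  have hC : ENNReal.ofReal C₀ ≠ 0 := by simpa using hC₀
  have h1 : distA A p (stratum I) < distA A p (stratumBoundary I) / ENNReal.ofReal C₀ :=
    (ENNReal.lt_div_iff_mul_lt (.inl hC) (.inl ENNReal.ofReal_ne_top)).2 (by
      rw [mul_comm]; exact hp)
  obtain ⟨q, hq⟩ := iInf_lt_iff.1 h1
  obtain ⟨hqI, hq⟩ := iInf_lt_iff.1 hq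
  refine ⟨q, hqI, fun s hs => ?_⟩
  rw [ENNReal.lt_div_iff_mul_lt (.inl hC) (.inl ENNReal.ofReal_ne_top)] at hq
  have h2 := hq.trans_le (distA_le p hs)
  rw [mul_comm, ← ENNReal.ofReal_mul hC₀.le] at h2
  exact (ENNReal.ofReal_lt_ofReal_iff_of_nonneg (mul_nonneg hC₀.le (Real.sqrt_nonneg _))).1 h2

theorem region_anti {C C' : ℝ} (h : C ≤ C') (I : Finset (Fin (N + 1))) :
    region A C' I ⊆ region A C I := fun _ hp =>
  lt_of_le_of_lt (mul_le_mul_left (ENNReal.ofReal_le_ofReal h) _) (show _ < _ from hp)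

/-- The threshold for the constant `C₀`. -/
def regionConst (N : ℕ) (lam Lam : ℝ) : ℝ :=
  max 1 (5 * upperConst N Lam / lowerConst N lam)

/-- In `B_I`, a set where `μ_k ≤ μ_i` for some `k ∉ I` is no closer than a multiple of the distance
to `D_{I ∪ k}`. -/
theorem IsPinched.exists_distA_insert (hA : IsPinched A lam Lam) (hLam : 0 < Lam)
    {I : Finset (Fin (N + 1))} {i k : Fin (N + 1)} (hi : i ∈ I) (hk : k ∉ I) {p : Base N}
    (hp : p ∈ region A (regionConst N lam Lam) I) :
    ∃ d > 0, distA A p (stratum (insert k I)) = ENNReal.ofReal d ∧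
      ∀ s : Base N, mu s k ≤ mu s i → d ≤ 5 * upperConst N Lam * ‖p - s‖ := by
  have hc1 := lowerConst_pos (N := N) hA.pos
  have hc2 := upperConst_pos (N := N) hLam
  have hC0 : 0 < regionConst N lam Lam := lt_of_lt_of_le one_pos (le_max_left _ _)
  obtain ⟨q, hqI, hq⟩ := exists_of_mem_region hC0 hp
  obtain ⟨hq0, hqe, hqk⟩ := (mem_stratum_iff hi q).1 hqI
  set τ := mu q k - mu q i with hτ
  have hτ0 : 0 < τ := sub_pos.2 (hqk k hk)
  -- Moving along `-e_k` by `τ` lowers `μ_k - μ_i` to zero and changes no other `μ_a - μ_i`, so `q'`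
  -- lands in `D_{I ∪ k}`.
  set q' := q - ray (Pi.single k τ) with hq'
  have hki : k ≠ i := fun h => hk (h ▸ hi)
  have hmu : ∀ a, mu q' a - mu q' i = mu q a - mu q i - (Pi.single k τ : Fin (N + 1) → ℝ) a := by
    intro a
    rw [hq', mu_sub, mu_sub, mu_ray, mu_ray, Pi.single_eq_of_ne hki.symm]
    ring
  have hq'K : q' ∈ stratum (insert k I) := by
    refine (mem_stratum_iff (Finset.mem_insert_of_mem hi) q').2 ⟨?_, fun a ha => ?_, fun a ha => ?_⟩
    · simp [hq', hq0, ray]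
    · rw [← sub_eq_zero, hmu]
      rcases Finset.mem_insert.1 ha with rfl | ha
      · simp [hτ]
      · have hak : a ≠ k := fun h => hk (h ▸ ha)
        rw [Pi.single_eq_of_ne hak, hqe a ha]; simp
    · rw [Finset.mem_insert, not_or] at ha
      rw [← sub_pos, hmu, Pi.single_eq_of_ne ha.1]
      linarith [hqk a ha.2]
  have hIK : I ⊂ insert k I := Finset.ssubset_insert hk
  have h1 := hq q' (stratum_subset_boundary hIK hq'K)
  have h2 : normA A (p - q') ≤ upperConst N Lam * (‖p - q‖ + τ) := by
    refine (hA.normA_le_upper hLam _).trans ?_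
    gcongr
    have := norm_add_le (p - q) (ray (Pi.single k τ))
    rw [show p - q' = p - q + ray (Pi.single k τ) by rw [hq']; abel]
    linarith [norm_ray_single_le (N := N) k τ, abs_of_pos hτ0]
  have h3 : 5 * upperConst N Lam * ‖p - q‖ ≤ regionConst N lam Lam * normA A (p - q) := by
    calc 5 * upperConst N Lam * ‖p - q‖
        = 5 * upperConst N Lam / lowerConst N lam * (lowerConst N lam * ‖p - q‖) := by field_simp
      _ ≤ _ := mul_le_mul (le_max_right _ _) (hA.lower_le_normA _) (by positivity) hC0.le
  -- Since `q' ∈ ∂D_I`, the region inequality gives `5 ‖p - q‖ < ‖p - q‖ + τ` after division by the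
  -- upper norm constant; this is the origin of the `5` in `regionConst`.
  have h4 : 4 * ‖p - q‖ < τ := by
    have : upperConst N Lam * (5 * ‖p - q‖) < upperConst N Lam * (‖p - q‖ + τ) := by linarith
    linarith [lt_of_mul_lt_mul_left this hc2.le]
  have hdle := distA_le (A := A) p hq'K
  have hdtop : distA A p (stratum (insert k I)) ≠ ⊤ := (hdle.trans_lt ENNReal.ofReal_lt_top).ne
  have hdpos : distA A p (stratum (insert k I)) ≠ 0 :=
    ((zero_le.trans_lt (show _ < _ from hp)).trans_le (distA_boundary_le hIK p)).ne'
  refine ⟨_, ENNReal.toReal_pos hdpos hdtop, (ENNReal.ofReal_toReal hdtop).symm, fun s hs => ?_⟩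
  have h5 : (distA A p (stratum (insert k I))).toReal ≤ normA A (p - q') :=
    ENNReal.toReal_le_of_le_ofReal (Real.sqrt_nonneg _) hdle
  -- Between `s` and `q` the difference `μ_k - μ_i` grows by at least `τ`, while it is 2-Lipschitz.
  -- With `h4` this yields `τ ≤ 4 ‖p - s‖` and `‖p - q‖ ≤ ‖p - s‖`.
  have h6 : τ ≤ 2 * (‖p - q‖ + ‖p - s‖) := by
    have ha := (le_abs_self _).trans (abs_mu_sub_mu_le (q - s) k i)
    rw [mu_sub, mu_sub] at ha
    have hb := norm_sub_le (p - s) (p - q)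
    rw [show p - s - (p - q) = q - s by abel] at hb
    linarith
  calc _ ≤ upperConst N Lam * (‖p - q‖ + τ) := h5.trans h2
    _ ≤ upperConst N Lam * (5 * ‖p - s‖) := by gcongr; linarith
    _ = _ := by ring

/-- Taking `k ∈ J \ I` with `D_{I ∪ k}` nearest to `p` gives one distance that serves for every
constraint in `J \ I`. This is the source of the maximum over `K`. -/
theorem IsPinched.exists_distA_between (hA : IsPinched A lam Lam) (hLam : 0 < Lam)
    {I J : Finset (Fin (N + 1))} {i : Fin (N + 1)} (hi : i ∈ I) (hIJ : I ⊂ J) {p : Base N}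
    (hp : p ∈ region A (regionConst N lam Lam) I) :
    ∃ K, (I ⊆ K ∧ K ⊆ J ∧ K.card = I.card + 1) ∧ I ⊂ K ∧
      ∃ d > 0, distA A p (stratum K) = ENNReal.ofReal d ∧
      ∀ s : Base N, (∃ k ∈ J, k ∉ I ∧ mu s k ≤ mu s i) → d ≤ 5 * upperConst N Lam * ‖p - s‖ := by
  have hne : (J \ I).Nonempty := Finset.sdiff_nonempty.2 hIJ.2
  obtain ⟨k, hk, hmin⟩ := (J \ I).exists_min_image
    (fun k => distA A p (stratum (insert k I))) hne
  rw [Finset.mem_sdiff] at hk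
  refine ⟨insert k I, ⟨Finset.subset_insert _ _, Finset.insert_subset hk.1 hIJ.1,
    Finset.card_insert_of_notMem hk.2⟩, Finset.ssubset_insert hk.2, ?_⟩
  obtain ⟨d, hd0, hd, -⟩ := hA.exists_distA_insert hLam hi hk.2 hp
  refine ⟨d, hd0, hd, fun s ⟨l, hlJ, hlI, hs⟩ => ?_⟩
  obtain ⟨d', hd0', hd', h⟩ := hA.exists_distA_insert hLam hi hlI hp
  have := hmin l (Finset.mem_sdiff.2 ⟨hlJ, hlI⟩)
  rw [hd, hd', ENNReal.ofReal_le_ofReal_iff hd0'.le] at this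
  exact this.trans (h s hs)

end Strata

/-! ### Linear parametrization of the cones -/

section Cones

variable {N : ℕ} {A : Matrix (Fin N) (Fin N) ℝ} {lam Lam : ℝ} {i j : Fin (N + 1)}

/-- The space of parameters `t_k`, `k ≠ i, j`. -/
abbrev Param (i j : Fin (N + 1)) : Type := {k : Fin (N + 1) // k ≠ i ∧ k ≠ j} → ℝ

/-- Extension by zero of parameters. -/
def extendParam (i j : Fin (N + 1)) : Param i j →ₗ[ℝ] (Fin (N + 1) → ℝ) where
  toFun t k := if h : k ≠ i ∧ k ≠ j then t ⟨k, h⟩ else 0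
  map_add' t t' := by
    funext k
    by_cases h : k ≠ i ∧ k ≠ j <;> simp [h]
  map_smul' s t := by
    funext k
    by_cases h : k ≠ i ∧ k ≠ j <;> simp [h]

theorem extendParam_of_ne (t : Param i j) {k : Fin (N + 1)} (h : k ≠ i ∧ k ≠ j) :
    extendParam i j t k = t ⟨k, h⟩ := dif_pos h

theorem extendParam_of_eq (t : Param i j) {k : Fin (N + 1)} (h : ¬(k ≠ i ∧ k ≠ j)) :
    extendParam i j t k = 0 := dif_neg h

theorem extendParam_left (t : Param i j) : extendParam i j t i = 0 :=
  extendParam_of_eq t (by simp)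

theorem extendParam_right (t : Param i j) : extendParam i j t j = 0 :=
  extendParam_of_eq t (by simp)

/-- The parametrization of the affine span of `D_{ij}`. -/
def conePoint (i j : Fin (N + 1)) : Param i j →L[ℝ] Base N :=
  LinearMap.toContinuousLinearMap (ray ∘ₗ extendParam i j)

theorem conePoint_apply (t : Param i j) : conePoint i j t = ray (extendParam i j t) := rfl

theorem mu_conePoint_sub (t : Param i j) (a : Fin (N + 1)) :
    mu (conePoint i j t) a - mu (conePoint i j t) i = extendParam i j t a := by
  rw [conePoint_apply, mu_ray, mu_ray, extendParam_left]
  ring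

/-- The coordinates `μ_k - μ_i`, a left inverse of the parametrization of the span of `D_{ij}`. -/
def coneCoord (i j : Fin (N + 1)) : Base N →L[ℝ] Param i j :=
  LinearMap.toContinuousLinearMap
    { toFun := fun p k => mu p k - mu p i
      map_add' := fun p q => by
        funext k
        have h := fun a => mu_sub (p + q) q a
        simp only [add_sub_cancel_right] at h
        simp only [Pi.add_apply, h]
        ring
      map_smul' := fun s p => by
        funext k
        simp only [mu_smul, Pi.smul_apply, smul_eq_mul, RingHom.id_apply]
        ring }

theorem coneCoord_apply (p : Base N) (k) : coneCoord i j p k = mu p k - mu p i := rfl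

theorem coneCoord_conePoint (t : Param i j) : coneCoord i j (conePoint i j t) = t := by
  funext k
  rw [coneCoord_apply, mu_conePoint_sub, extendParam_of_ne t k.2]

theorem norm_coneCoord_le (p : Base N) : ‖coneCoord i j p‖ ≤ 2 * ‖p‖ :=
  (pi_norm_le_iff_of_nonneg (by positivity)).2 fun k => abs_mu_sub_mu_le p k i

/-- The kernel degree `N` exceeds the dimension of the cone by exactly one: enough for convergence
at infinity, and the case where potentials scale like an inverse distance. -/
theorem finrank_param (hij : i ≠ j) : Module.finrank ℝ (Param i j) + 1 = N := by
  have h : Fintype.card {k : Fin (N + 1) // k ≠ i ∧ k ≠ j} = (({i, j} : Finset (Fin (N + 1)))ᶜ).card :=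
    Fintype.card_of_subtype _ fun k => by simp
  have hle := Finset.card_le_univ ({i, j} : Finset (Fin (N + 1)))
  rw [Module.finrank_fintype_fun_eq_card, h, Finset.card_compl]
  rw [Finset.card_pair hij, Fintype.card_fin] at *
  omega

/-- The parameters with `t_k > 0` for `k ∈ S`. -/
def positiveOn (i j : Fin (N + 1)) (S : Finset (Fin (N + 1))) : Set (Param i j) :=
  {t | ∀ k, k.1 ∈ S → 0 < t k}

theorem measurableSet_positiveOn (S : Finset (Fin (N + 1))) : MeasurableSet (positiveOn i j S) := by
  have : positiveOn i j S = ⋂ k, ⋂ _ : k.1 ∈ S, {t | 0 < t k} := by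
    ext t; simp [positiveOn]
  rw [this]
  exact MeasurableSet.iInter fun k => MeasurableSet.iInter fun _ =>
    measurableSet_lt measurable_const (measurable_pi_apply k)

theorem positiveOn_anti {S S' : Finset (Fin (N + 1))} (h : S ⊆ S') :
    positiveOn i j S' ⊆ positiveOn i j S := fun _ ht k hk => ht k (h hk)

/-- The points of `D_{ij}` are at positive distance from a point off its closure. -/
theorem mem_clearSet_of_mem_finiteSet (hij : i ≠ j) {p : Base N} (hp : p ∈ finiteSet i j) :
    p ∈ clearSet (conePoint i j) (positiveOn i j Finset.univ) := by
  have h := hp hij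
  rw [Metric.mem_closure_iff] at h
  push Not at h
  obtain ⟨δ, hδ, h⟩ := h
  refine ⟨δ, hδ, fun t ht => ?_⟩
  rw [← dist_eq_norm]
  refine h _ ((mem_stratum_iff (Finset.mem_insert_self i _) _).2 ⟨rfl, fun k hk => ?_, fun k hk => ?_⟩)
  · rw [← sub_eq_zero, mu_conePoint_sub]
    rcases Finset.mem_insert.1 hk with rfl | hk
    · exact extendParam_left t
    · rw [Finset.mem_singleton.1 hk, extendParam_right]
  · have hk' : k ≠ i ∧ k ≠ j := by simpa [not_or] using hk
    rw [← sub_pos, mu_conePoint_sub, extendParam_of_ne t hk']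
    exact ht _ (Finset.mem_univ _)

/-- A parameter in the difference violates some constraint `t_k > 0` with `k ∈ J \ I`, and `t_k =
μ_k - μ_i` on the cone. -/
theorem IsPinched.exists_clear_distA (hA : IsPinched A lam Lam) (hLam : 0 < Lam)
    {I J : Finset (Fin (N + 1))} (hi : i ∈ I) (hIJ : I ⊂ J) {p : Base N}
    (hp : p ∈ region A (regionConst N lam Lam) I) :
    ∃ K, (I ⊆ K ∧ K ⊆ J ∧ K.card = I.card + 1) ∧ I ⊂ K ∧
      ∃ d > 0, distA A p (stratum K) = ENNReal.ofReal d ∧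
      ∀ t ∈ positiveOn i j I \ positiveOn i j J,
        d / (5 * upperConst N Lam) ≤ ‖p - conePoint i j t‖ := by
  obtain ⟨K, hK, hIK, d, hd0, hd, h⟩ := hA.exists_distA_between hLam hi hIJ hp
  refine ⟨K, hK, hIK, d, hd0, hd, fun t ⟨htI, htJ⟩ => ?_⟩
  have hc2 := upperConst_pos (N := N) hLam
  rw [div_le_iff₀ (by positivity), mul_comm]
  refine h _ ?_
  simp only [positiveOn, Set.mem_ofPred_eq, not_forall, not_lt] at htJ
  obtain ⟨k, hkJ, hk⟩ := htJ
  refine ⟨k, hkJ, fun hkI => absurd (htI k hkI) (not_lt.2 hk), ?_⟩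
  rw [← sub_nonpos, mu_conePoint_sub, extendParam_of_ne t k.2]
  exact hk

end Cones

/-! ### The two integral formulas as one cone potential -/

section Unification

variable {N : ℕ} {A : Matrix (Fin N) (Fin N) ℝ} {lam Lam : ℝ} {i j : Fin (N + 1)}

/-- The potential of `|·|_A^{-N}` of the set of points with parameters in `T`. -/
def potential (A : Matrix (Fin N) (Fin N) ℝ) (i j : Fin (N + 1)) (T : Set (Param i j))
    (p : Base N) : ℝ :=
  ∫ t in T, (normA A (p - conePoint i j t) ^ N)⁻¹

theorem setIntegral_positive_comp_equiv {ι ι' : Type} [Fintype ι] [Fintype ι'] (e : ι' ≃ ι)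
    (f : (ι → ℝ) → ℝ) :
    ∫ t in {t : ι → ℝ | ∀ k, 0 < t k}, f t =
      ∫ t in {t : ι' → ℝ | ∀ k, 0 < t k}, f (fun k => t (e.symm k)) := by
  have h := (volume_measurePreserving_piCongrLeft (fun _ : ι => ℝ) e).setIntegral_preimage_emb
    (MeasurableEquiv.measurableEmbedding _) f {t : ι → ℝ | ∀ k, 0 < t k}
  have hc : ∀ t : ι' → ℝ, MeasurableEquiv.piCongrLeft (fun _ : ι => ℝ) e t =
      fun k => t (e.symm k) := fun t => by
    funext k
    obtain ⟨k, rfl⟩ := e.surjective k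
    rw [Equiv.symm_apply_apply]
    exact Equiv.piCongrLeft_apply_apply (P := fun _ : ι => ℝ) e t k
  rw [← h]
  simp only [hc]
  congr 2
  ext t
  simp only [Set.mem_preimage, hc, Set.mem_ofPred_eq]
  exact ⟨fun h k => by simpa using h (e k), fun h k => h _⟩

theorem setIntegral_positive_option {ι : Type} [Fintype ι] (f : (Option ι → ℝ) → ℝ) :
    ∫ t in {t : Option ι → ℝ | ∀ k, 0 < t k}, f t =
      ∫ x in {x : (ι → ℝ) × ℝ | (∀ k, 0 < x.1 k) ∧ 0 < x.2},
        f ((MeasurableEquiv.piOptionEquivProd fun _ : Option ι => ℝ).symm x) := by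
  have hp : MeasurePreserving (MeasurableEquiv.piOptionEquivProd fun _ : Option ι => ℝ).symm
      (volume : Measure ((ι → ℝ) × ℝ)) volume :=
    ⟨MeasurableEquiv.measurable _,
      Measure.pi_map_piOptionEquivProd (β := fun _ : Option ι => ℝ) fun _ => volume⟩
  rw [← hp.setIntegral_preimage_emb (MeasurableEquiv.measurableEmbedding _) f]
  congr 2
  ext x
  simp only [Set.mem_preimage, Set.mem_ofPred_eq, Option.forall]
  exact and_comm

theorem positiveOn_univ : positiveOn i j Finset.univ = {t | ∀ k, 0 < t k} := by
  ext t; simp [positiveOn]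

/-- The hypothesis `h` says `{i, j} = {0, k + 1}` without fixing an order, so `α_{0k}` and `α_{k0}`
are treated together. -/
theorem alphaZero_eq (k : Fin N) (h : ∀ l, (l ≠ i ∧ l ≠ j) ↔ (l ≠ 0 ∧ l ≠ k.succ))
    (p : Base N) :
    alphaZero A k p = greenConst A * potential A i j (positiveOn i j Finset.univ) p := by
  let e : {l : Fin N // l ≠ k} ≃ {l : Fin (N + 1) // l ≠ i ∧ l ≠ j} :=
    Equiv.ofBijective (fun l => ⟨l.1.succ, (h _).2 ⟨Fin.succ_ne_zero _, by simpa using l.2⟩⟩)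
      ⟨fun l l' hl => by simpa [Subtype.ext_iff] using hl, fun ⟨l, hl⟩ => by
        have hl' := (h l).1 hl
        obtain ⟨m, rfl⟩ := Fin.exists_succ_eq.2 hl'.1
        exact ⟨⟨m, by simpa using hl'.2⟩, rfl⟩⟩
  rw [alphaZero, potential, positiveOn_univ, setIntegral_positive_comp_equiv e]
  simp only [one_div]
  suffices key : ∀ t, ((extendZero t, 0) : Base N) = conePoint i j fun l => t (e.symm l) by
    simp only [key]
  intro t
  have h0 : extendParam i j (fun l => t (e.symm l)) 0 = 0 :=
    extendParam_of_eq _ fun h' => ((h 0).1 h').1 rfl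
  refine Prod.ext (funext fun l => ?_) rfl
  change extendZero t l = extendParam i j _ l.succ - extendParam i j _ 0
  rw [h0, sub_zero]
  by_cases hl : l = k
  · subst hl
    rw [extendZero, dif_neg (by simp)]
    exact (extendParam_of_eq _ fun h' => ((h _).1 h').2 rfl).symm
  · rw [extendZero, dif_pos hl, extendParam_of_ne _ ((h _).2 ⟨Fin.succ_ne_zero _, by simpa using hl⟩)]
    congr 1
    exact ((Equiv.symm_apply_eq e).2 rfl).symm

/-- The variable `s` is the parameter `t_0`: adding `s (1, …, 1)` is subtracting `s e_0`. It
occupies the `none` slot of the reindexing `e`. -/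
theorem alphaPos_eq (k l : Fin N) (p : Base N) :
    alphaPos A k l p =
      greenConst A * potential A k.succ l.succ (positiveOn k.succ l.succ Finset.univ) p := by
  let e : Option {m : Fin N // m ≠ k ∧ m ≠ l} ≃
      {m : Fin (N + 1) // m ≠ k.succ ∧ m ≠ l.succ} :=
    Equiv.ofBijective (fun m => m.elim ⟨0, (Fin.succ_ne_zero _).symm, (Fin.succ_ne_zero _).symm⟩
        fun m => ⟨m.1.succ, by simpa using m.2⟩)
      ⟨fun m m' hm => by
        rcases m with _ | m <;> rcases m' with _ | m' <;>
          simp [Subtype.ext_iff, (Fin.succ_ne_zero _).symm] at hm ⊢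
        exact hm, fun ⟨m, hm⟩ => by
        cases m using Fin.cases with
        | zero => exact ⟨none, rfl⟩
        | succ m => exact ⟨some ⟨m, by simpa using hm⟩, rfl⟩⟩
  rw [alphaPos, potential, positiveOn_univ, setIntegral_positive_comp_equiv e,
    setIntegral_positive_option]
  simp only [one_div]
  suffices key : ∀ x : ({m : Fin N // m ≠ k ∧ m ≠ l} → ℝ) × ℝ,
      ((extendZero x.1, 0) - x.2 • (fun _ => 1, 0) : Base N) = conePoint k.succ l.succ fun m =>
        (MeasurableEquiv.piOptionEquivProd fun _ => ℝ).symm x (e.symm m) by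
    simp only [← key, sub_add]
  intro x
  set y := (MeasurableEquiv.piOptionEquivProd fun _ => ℝ).symm x with hy
  have h0 : extendParam k.succ l.succ (fun m => y (e.symm m)) 0 = x.2 := by
    rw [extendParam_of_ne _ ⟨(Fin.succ_ne_zero _).symm, (Fin.succ_ne_zero _).symm⟩]
    change y (e.symm (e none)) = x.2
    rw [Equiv.symm_apply_apply]
    rfl
  refine Prod.ext (funext fun m => ?_) (by simp [conePoint_apply, ray])
  change extendZero x.1 m - x.2 * 1 = extendParam _ _ _ m.succ - extendParam _ _ _ 0
  rw [h0, mul_one]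
  congr 1
  by_cases hm : m ≠ k ∧ m ≠ l
  · rw [extendZero, dif_pos hm, extendParam_of_ne _ (by simpa using hm)]
    change _ = y (e.symm (e (some ⟨m, hm⟩)))
    rw [Equiv.symm_apply_apply]
    rfl
  · rw [extendZero, dif_neg hm]
    exact (extendParam_of_eq _ (by simpa using hm)).symm

/-- All the `α_{ij}` are potentials of the cones `D_{ij}`. -/
theorem alpha_eq (hij : i ≠ j) (p : Base N) :
    alpha A i j p = greenConst A * potential A i j (positiveOn i j Finset.univ) p := by
  rw [alpha, if_neg hij]
  cases i using Fin.cases with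
  | zero =>
    cases j using Fin.cases with
    | zero => exact absurd rfl hij
    | succ l => exact alphaZero_eq l (fun _ => Iff.rfl) p
  | succ k =>
    cases j using Fin.cases with
    | zero => exact alphaZero_eq k (fun _ => and_comm) p
    | succ l => exact alphaPos_eq k l p

end Unification

/-! ### The invariant parts and the remainders -/

section Parts

variable {N : ℕ} {A : Matrix (Fin N) (Fin N) ℝ} {lam Lam : ℝ} {i j : Fin (N + 1)}

theorem IsPinched.integrableOn_kernel (hA : IsPinched A lam Lam) (hij : i ≠ j)
    {T : Set (Param i j)} (hT : MeasurableSet T) {p : Base N} (hp : p ∈ clearSet (conePoint i j) T) :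
    IntegrableOn (fun t => (normA A (p - conePoint i j t) ^ N)⁻¹) T :=
  (hA.isHomogeneousKernel N).integrableOn (by have := finrank_param hij; omega)
    coneCoord_conePoint hT hp

theorem IsPinched.contDiffOn_potential (hA : IsPinched A lam Lam) (hij : i ≠ j)
    {T : Set (Param i j)} (hT : MeasurableSet T) :
    ContDiffOn ℝ ∞ (potential A i j T) (clearSet (conePoint i j) T) :=
  contDiffOn_infty.2 fun n => TaubNUT.contDiffOn_potential coneCoord_conePoint hT n
    (hA.isHomogeneousKernel N) (by have := finrank_param hij; omega)

/-- The trace with respect to `A ⊕ det A`, as a continuous functional. -/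
def traceCLM (A : Matrix (Fin N) (Fin N) ℝ) : (Base N →L[ℝ] Base N →L[ℝ] ℝ) →L[ℝ] ℝ :=
  LinearMap.toContinuousLinearMap
    { toFun := fun B : Base N →L[ℝ] Base N →L[ℝ] ℝ => traceA A fun u v => B u v
      map_add' := fun B B' => by
        simp only [traceA, add_apply, mul_add, Finset.sum_add_distrib]
        ring
      map_smul' := fun s B => by
        simp only [traceA, smul_apply, smul_eq_mul, mul_add, Finset.mul_sum, RingHom.id_apply]
        simp only [mul_left_comm] }

theorem laplacianA_congr {f g : Base N → ℝ} {p : Base N} (h : f =ᶠ[nhds p] g) :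
    laplacianA A f p = laplacianA A g p := by
  rw [laplacianA_eq, laplacianA_eq, h.fderiv.fderiv_eq]

theorem laplacianA_const_mul (c : ℝ) (f : Base N → ℝ) (p : Base N) :
    laplacianA A (fun q => c * f q) p = c * laplacianA A f p := by
  have h1 : fderiv ℝ (fun q => c * f q) = c • fderiv ℝ f := by
    funext q
    exact congrFun (fderiv_const_smul_field (𝕜 := ℝ) (f := f) c) q
  have h2 : fderiv ℝ (c • fderiv ℝ f) p = c • fderiv ℝ (fderiv ℝ f) p :=
    congrFun (fderiv_const_smul_field (𝕜 := ℝ) (f := fderiv ℝ f) c) p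
  rw [laplacianA_eq, laplacianA_eq, h1, h2]
  exact (traceCLM A).map_smul c _

theorem IsPinched.laplacianA_potential (hA : IsPinched A lam Lam) (hij : i ≠ j)
    {T : Set (Param i j)} (hT : MeasurableSet T) {p : Base N}
    (hp : p ∈ clearSet (conePoint i j) T) : laplacianA A (potential A i j T) p = 0 := by
  have hm : Module.finrank ℝ (Param i j) < N := by have := finrank_param hij; omega
  have hG := hA.isHomogeneousKernel N
  have h := fderiv_fderiv_potential (μ := volume) coneCoord_conePoint hT hG hm hp
  have hint := hG.fderiv.fderiv.integrableOn (μ := volume) (by omega) coneCoord_conePoint hT hp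
  rw [laplacianA_eq]
  change traceCLM A (fderiv ℝ (fderiv ℝ fun q => ∫ t in T, (normA A (q - conePoint i j t) ^ N)⁻¹) p)
    = 0
  rw [h, ← (traceCLM A).integral_comp_comm hint]
  refine setIntegral_eq_zero_of_forall_eq_zero fun t ht => hA.traceA_fderiv_kernel ?_
  obtain ⟨δ, hδ, hp⟩ := hp
  exact norm_pos_iff.1 (hδ.trans_le (hp t ht))

/-- The potentials of cones and of their differences are bounded by the inverse distance. -/
theorem exists_greenConst_mul_potential_le (N : ℕ) (lam Lam : ℝ) (hlam : 0 < lam) :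
    ∃ C, 0 ≤ C ∧ ∀ A : Matrix (Fin N) (Fin N) ℝ, IsPinched A lam Lam →
      ∀ i j : Fin (N + 1), i ≠ j → ∀ T : Set (Param i j), MeasurableSet T → ∀ p δ, 0 < δ →
        (∀ t ∈ T, δ ≤ ‖p - conePoint i j t‖) → |greenConst A * potential A i j T p| ≤ C / δ := by
  have hc1 := lowerConst_pos (N := N) hlam
  have key : ∀ x : Fin (N + 1) × Fin (N + 1), ∃ C, 0 ≤ C ∧
      ∀ A : Matrix (Fin N) (Fin N) ℝ, IsPinched A lam Lam → x.1 ≠ x.2 →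
        ∀ T : Set (Param x.1 x.2), MeasurableSet T → ∀ p δ, 0 < δ →
          (∀ t ∈ T, δ ≤ ‖p - conePoint x.1 x.2 t‖) → |potential A x.1 x.2 T p| ≤ C / δ := by
    rintro ⟨i, j⟩
    by_cases hij : i = j
    · exact ⟨0, le_rfl, fun _ _ h => absurd hij h⟩
    obtain ⟨C, hC0, hC⟩ := exists_potential_bound (V := Param i j) (E := Base N) (F := ℝ)
      (μ := volume) (finrank_param hij) (M := 2) (by norm_num) (K := (lowerConst N lam ^ N)⁻¹)
      (by positivity)
    refine ⟨C, hC0, fun A hA _ T hT p δ hδ hp => ?_⟩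
    refine hC (conePoint i j) (coneCoord i j) coneCoord_conePoint norm_coneCoord_le
      (fun q => (normA A q ^ N)⁻¹) (fun x hx => ?_) T hT p δ hδ hp
    have hx' := norm_pos_iff.2 hx
    have hpos := hA.normA_pos hx
    rw [← mul_inv, ← mul_pow, Real.norm_of_nonneg (by positivity)]
    gcongr
    exact hA.lower_le_normA x
  choose C hC0 hC using key
  -- Summing over the finitely many pairs makes the constant independent of `i` and `j`.
  refine ⟨greenBound N Lam * ∑ x, C x, mul_nonneg greenBound_nonneg (Finset.sum_nonneg fun x _ => hC0 x),
    fun A hA i j hij T hT p δ hδ hp => ?_⟩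
  rw [abs_mul, abs_of_nonneg greenConst_nonneg, mul_div_assoc]
  refine mul_le_mul hA.greenConst_le ((hC (i, j) A hA hij T hT p δ hδ hp).trans ?_) (abs_nonneg _)
    greenBound_nonneg
  gcongr
  exact Finset.single_le_sum (f := C) (fun x _ => hC0 x) (Finset.mem_univ (i, j))

/-- The part of `α_{ij}` invariant along `D_I`, for `i, j ∈ I`: the potential of the cone obtained
from `D_{ij}` by dropping the constraints for `k ∉ I`. -/
def alphaPart (A : Matrix (Fin N) (Fin N) ℝ) (I : Finset (Fin (N + 1))) (i j : Fin (N + 1))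
    (p : Base N) : ℝ :=
  if i ∈ I ∧ j ∈ I ∧ i ≠ j then greenConst A * potential A i j (positiveOn i j I) p else 0

open Classical in
/-- The remainder `α_{ij} - α_{I,ij}`, extended over the closure of `D_{ij}`. -/
def betaPart (A : Matrix (Fin N) (Fin N) ℝ) (I : Finset (Fin (N + 1))) (i j : Fin (N + 1))
    (p : Base N) : ℝ :=
  if i ∈ I ∧ j ∈ I ∧ i ≠ j ∧ p ∉ finiteSet i j then
    -greenConst A * potential A i j (positiveOn i j I \ positiveOn i j Finset.univ) p
  else alpha A i j p - alphaPart A I i j p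

theorem alphaPart_of_ne {I : Finset (Fin (N + 1))} (hi : i ∈ I) (hj : j ∈ I) (hij : i ≠ j)
    (p : Base N) :
    alphaPart A I i j p = greenConst A * potential A i j (positiveOn i j I) p :=
  if_pos ⟨hi, hj, hij⟩

theorem alphaPart_self (I : Finset (Fin (N + 1))) (p : Base N) : alphaPart A I i i p = 0 :=
  if_neg (by simp)

theorem betaPart_self (I : Finset (Fin (N + 1))) (p : Base N) : betaPart A I i i p = 0 := by
  rw [betaPart, if_neg (by simp), alphaPart_self, alpha, if_pos rfl, sub_zero]

theorem betaPart_of_mem_finiteSet (I : Finset (Fin (N + 1))) {p : Base N}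
    (hp : p ∈ finiteSet i j) : betaPart A I i j p = alpha A i j p - alphaPart A I i j p :=
  if_neg fun h => h.2.2.2 hp

theorem parts_of_notMem {I : Finset (Fin (N + 1))} (h : i ∉ I ∨ j ∉ I) (p : Base N) :
    alphaPart A I i j p = 0 ∧ betaPart A I i j p = alpha A i j p := by
  have h1 : alphaPart A I i j p = 0 := if_neg (by tauto)
  exact ⟨h1, by rw [betaPart, if_neg (by tauto), h1, sub_zero]⟩

/-- Here `q - p` is the cone point with parameter `w`, and `w` vanishes on `I`. Translation by `w`
preserves both Lebesgue measure and the constraints indexed by `I`, and carries one integral to the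
other. -/
theorem alphaPart_eq_of_mu_sub_eq {I : Finset (Fin (N + 1))} (hi : i ∈ I) (hj : j ∈ I)
    {p q : Base N} (h : ∀ a ∈ I, ∀ b ∈ I, mu p a - mu p b = mu q a - mu q b) (hη : p.2 = q.2) :
    alphaPart A I i j p = alphaPart A I i j q := by
  by_cases hij : i = j
  · subst hij; rw [alphaPart_self, alphaPart_self]
  rw [alphaPart_of_ne hi hj hij, alphaPart_of_ne hi hj hij]
  congr 1
  set w : Param i j := coneCoord i j (q - p) with hw
  have hext : ∀ a, extendParam i j w a = mu (q - p) a - mu (q - p) i := fun a => by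
    by_cases ha : a ≠ i ∧ a ≠ j
    · rw [extendParam_of_ne _ ha, hw, coneCoord_apply]
    · rw [extendParam_of_eq _ ha]
      have haI : a ∈ I := by
        by_contra haI
        exact ha ⟨fun h => haI (h ▸ hi), fun h => haI (h ▸ hj)⟩
      rw [mu_sub, mu_sub]
      linarith [h a haI i hi]
  have hLw : conePoint i j w = q - p := by
    refine Prod.ext (funext fun k => ?_) (by simp [conePoint_apply, ray, hη])
    change extendParam i j w k.succ - extendParam i j w 0 = (q - p).1 k
    rw [hext, hext, mu_zero, mu_succ]
    ring
  have hmp := (measurePreserving_add_right (volume : Measure (Param i j)) w).setIntegral_preimage_emb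
    (measurableEmbedding_addRight w) (fun t => (normA A (q - conePoint i j t) ^ N)⁻¹)
    (positiveOn i j I)
  rw [potential, potential, ← hmp]
  congr! 2
  · ext t
    simp only [positiveOn, Set.mem_preimage, Set.mem_ofPred_eq, Pi.add_apply]
    refine forall₂_congr fun k hk => ?_
    have : w k = 0 := by
      rw [hw, coneCoord_apply, mu_sub, mu_sub]
      linarith [h k.1 hk i hi]
    rw [this, add_zero]
  · rw [map_add, hLw]
    abel_nf

/-- Where `α_{ij}` is finite, both pieces of the larger cone are integrable and the integral splits;
elsewhere this is the definition. Thus one formula, smooth across the closure of `D_{ij}`, covers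
both cases. -/
theorem IsPinched.betaPart_eq (hA : IsPinched A lam Lam) {I : Finset (Fin (N + 1))} (hi : i ∈ I)
    (hj : j ∈ I) (hij : i ≠ j) {p : Base N}
    (hp : p ∈ clearSet (conePoint i j) (positiveOn i j I \ positiveOn i j Finset.univ)) :
    betaPart A I i j p =
      -greenConst A * potential A i j (positiveOn i j I \ positiveOn i j Finset.univ) p := by
  by_cases hf : p ∈ finiteSet i j
  · have hu := mem_clearSet_of_mem_finiteSet hij hf
    have hsub : positiveOn i j Finset.univ ⊆ positiveOn i j I := positiveOn_anti (Finset.subset_univ I)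
    have hmu := measurableSet_positiveOn (i := i) (j := j) Finset.univ
    have hmI := measurableSet_positiveOn (i := i) (j := j) I
    have hint := (hA.integrableOn_kernel hij (hmI.diff hmu) hp).union
      (hA.integrableOn_kernel hij hmu hu)
    rw [Set.sdiff_union_of_subset hsub] at hint
    rw [betaPart_of_mem_finiteSet I hf, alpha_eq hij, alphaPart_of_ne hi hj hij]
    simp only [potential]
    rw [setIntegral_sdiff hmu hint hsub]
    ring
  · exact if_pos ⟨hi, hj, hij, hf⟩

/-- Only the potentials of the added parts are subtracted, never `α_{ij}` itself, so the identity
also holds where `α_{ij}` is infinite. -/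
theorem IsPinched.betaPart_sub (hA : IsPinched A lam Lam) {I J : Finset (Fin (N + 1))} (hIJ : I ⊆ J)
    (hi : i ∈ I) (hj : j ∈ I) (hij : i ≠ j) {p : Base N}
    (hp : p ∈ clearSet (conePoint i j) (positiveOn i j I \ positiveOn i j Finset.univ)) :
    betaPart A I i j p - betaPart A J i j p =
      -(greenConst A * potential A i j (positiveOn i j I \ positiveOn i j J) p) := by
  have hsub : positiveOn i j J \ positiveOn i j Finset.univ ⊆
      positiveOn i j I \ positiveOn i j Finset.univ := Set.sdiff_subset_sdiff_left (positiveOn_anti hIJ)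
  have hm := fun S => measurableSet_positiveOn (i := i) (j := j) S
  rw [hA.betaPart_eq hi hj hij hp, hA.betaPart_eq (hIJ hi) (hIJ hj) hij (clearSet_anti _ hsub hp)]
  have hd := setIntegral_sdiff ((hm J).diff (hm Finset.univ))
    (hA.integrableOn_kernel hij ((hm I).diff (hm Finset.univ)) hp) hsub
  -- True because the full cone lies inside the one for `J`.
  have hset : (positiveOn i j I \ positiveOn i j Finset.univ) \
      (positiveOn i j J \ positiveOn i j Finset.univ) = positiveOn i j I \ positiveOn i j J := by
    have := positiveOn_anti (i := i) (j := j) (Finset.subset_univ J)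
    ext t
    simp only [Set.mem_sdiff]
    have := @this t
    tauto
  rw [hset] at hd
  simp only [potential]
  rw [hd]
  ring

theorem IsPinched.mem_clearSet_of_mem_region (hA : IsPinched A lam Lam) (hLam : 0 < Lam)
    {I : Finset (Fin (N + 1))} (hi : i ∈ I) {p : Base N}
    (hp : p ∈ region A (regionConst N lam Lam) I) :
    p ∈ clearSet (conePoint i j) (positiveOn i j I \ positiveOn i j Finset.univ) := by
  by_cases hI : I = Finset.univ
  · exact ⟨1, one_pos, fun t ht => by simp [hI] at ht⟩
  · have hc2 := upperConst_pos (N := N) hLam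
    obtain ⟨-, -, -, d, hd, -, h⟩ :=
      hA.exists_clear_distA (j := j) hLam hi (Finset.ssubset_univ_iff.2 hI) hp
    exact ⟨_, by positivity, h⟩

end Parts

/-! ### Estimates and regularity of the remainders on `B_I` -/

section Comparison

variable {N : ℕ} {A : Matrix (Fin N) (Fin N) ℝ} {lam Lam : ℝ} {i j : Fin (N + 1)}

/-- The comparison of the remainders of nested strata, with a constant uniform in `A`. -/
theorem exists_betaPart_sub_le (N : ℕ) (lam Lam : ℝ) (hlam : 0 < lam) (hLam : 0 < Lam) :
    ∃ C, 0 < C ∧ ∀ A : Matrix (Fin N) (Fin N) ℝ, IsPinched A lam Lam →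
      ∀ I J : Finset (Fin (N + 1)), I ⊂ J → ∀ i ∈ I, ∀ j ∈ I,
        ∀ p ∈ region A (regionConst N lam Lam) I,
          ∃ K, (I ⊆ K ∧ K ⊆ J ∧ K.card = I.card + 1) ∧ I ⊂ K ∧
            ENNReal.ofReal |betaPart A I i j p - betaPart A J i j p| ≤
              ENNReal.ofReal C / distA A p (stratum K) := by
  obtain ⟨C, hC0, hC⟩ := exists_greenConst_mul_potential_le N lam Lam hlam
  have hc2 := upperConst_pos (N := N) hLam
  -- The summand `1` only makes the constant strictly positive.
  refine ⟨C * (5 * upperConst N Lam) + 1, by positivity, fun A hA I J hIJ i hi j hj p hp => ?_⟩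
  obtain ⟨K, hK, hIK, d, hd0, hd, h⟩ := hA.exists_clear_distA (j := j) hLam hi hIJ hp
  refine ⟨K, hK, hIK, ?_⟩
  rw [hd, ← ENNReal.ofReal_div_of_pos hd0]
  apply ENNReal.ofReal_le_ofReal
  by_cases hij : i = j
  · subst hij
    rw [betaPart_self, betaPart_self, sub_self, abs_zero]
    positivity
  rw [hA.betaPart_sub hIJ.1 hi hj hij (hA.mem_clearSet_of_mem_region hLam hi hp), abs_neg]
  refine (hC A hA i j hij _ ((measurableSet_positiveOn I).diff (measurableSet_positiveOn J)) p
    (d / (5 * upperConst N Lam)) (by positivity) h).trans ?_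
  rw [div_div_eq_mul_div]
  gcongr
  linarith

theorem betaPart_univ (hA : IsPinched A lam Lam) (i j : Fin (N + 1)) (p : Base N) :
    betaPart A Finset.univ i j p = 0 := by
  by_cases hij : i = j
  · subst hij; exact betaPart_self _ p
  rw [hA.betaPart_eq (Finset.mem_univ i) (Finset.mem_univ j) hij
    ⟨1, one_pos, fun t ht => by simp at ht⟩]
  simp [potential]

theorem IsPinched.betaPart_eqOn (hA : IsPinched A lam Lam) {I : Finset (Fin (N + 1))} (hi : i ∈ I)
    (hj : j ∈ I) (hij : i ≠ j) :
    Set.EqOn (betaPart A I i j) (fun p =>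
      -greenConst A * potential A i j (positiveOn i j I \ positiveOn i j Finset.univ) p)
      (clearSet (conePoint i j) (positiveOn i j I \ positiveOn i j Finset.univ)) :=
  fun _ hp => hA.betaPart_eq hi hj hij hp

theorem IsPinched.contDiffOn_betaPart (hA : IsPinched A lam Lam) (hLam : 0 < Lam)
    {I : Finset (Fin (N + 1))} (hi : i ∈ I) (hj : j ∈ I) :
    ContDiffOn ℝ ∞ (betaPart A I i j) (region A (regionConst N lam Lam) I) := by
  by_cases hij : i = j
  · subst hij
    exact contDiffOn_const.congr fun p _ => betaPart_self I p
  refine ContDiffOn.mono ?_ fun p hp => hA.mem_clearSet_of_mem_region (j := j) hLam hi hp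
  exact (contDiffOn_const.mul (hA.contDiffOn_potential hij ((measurableSet_positiveOn I).diff
    (measurableSet_positiveOn _)))).congr (hA.betaPart_eqOn hi hj hij)

theorem IsPinched.laplacianA_betaPart (hA : IsPinched A lam Lam) (hLam : 0 < Lam)
    {I : Finset (Fin (N + 1))} (hi : i ∈ I) (hj : j ∈ I) {p : Base N}
    (hp : p ∈ region A (regionConst N lam Lam) I) : laplacianA A (betaPart A I i j) p = 0 := by
  by_cases hij : i = j
  · subst hij
    -- Written as a product so that `laplacianA_const_mul` applies with factor zero.
    have h : betaPart A I i i = fun _ => (0 : ℝ) * 0 := funext fun q => by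
      rw [betaPart_self, zero_mul]
    rw [h, laplacianA_const_mul 0 (fun _ => 0), zero_mul]
  have hc := hA.mem_clearSet_of_mem_region (j := j) hLam hi hp
  rw [laplacianA_congr ((hA.betaPart_eqOn hi hj hij).eventuallyEq_of_mem
    ((isOpen_clearSet _ _).mem_nhds hc)), laplacianA_const_mul,
    hA.laplacianA_potential hij ((measurableSet_positiveOn I).diff (measurableSet_positiveOn _)) hc,
    mul_zero]

end Comparison

end TaubNUT

end

/-! ### Assembly of the statement -/

theorem lemma3p3 (N : ℕ) (lam Lam : ℝ) (hlam : 0 < lam) (hLam : lam ≤ Lam) :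
    ∃ Cstar : ℝ, 1 ≤ Cstar ∧ ∃ C : ℝ, 0 < C ∧
      ∀ A : Matrix (Fin N) (Fin N) ℝ, A.IsSymm →
        (∀ x : Fin N → ℝ, lam * (x ⬝ᵥ x) ≤ x ⬝ᵥ A *ᵥ x ∧ x ⬝ᵥ A *ᵥ x ≤ Lam * (x ⬝ᵥ x)) →
        ∃ α β : Finset (Fin (N + 1)) → Fin (N + 1) → Fin (N + 1) → TaubNUT.Base N → ℝ,
          -- the convention for indices outside `I`
          (∀ I : Finset (Fin (N + 1)), 2 ≤ I.card → ∀ i j, (i ∉ I ∨ j ∉ I) →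
            ∀ p, α I i j p = 0 ∧ β I i j p = TaubNUT.alpha A i j p) ∧
          ∀ I : Finset (Fin (N + 1)), 2 ≤ I.card → ∀ i ∈ I, ∀ j ∈ I,
            -- the decomposition
            (∀ p ∈ TaubNUT.finiteSet i j, TaubNUT.alpha A i j p = α I i j p + β I i j p) ∧
            -- `α_{I,ij}` depends only on the differences of `μ_a`, `a ∈ I`, and on `η`
            (∀ p q : TaubNUT.Base N,
              (∀ a ∈ I, ∀ b ∈ I,
                TaubNUT.mu p a - TaubNUT.mu p b = TaubNUT.mu q a - TaubNUT.mu q b) →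
              p.2 = q.2 → α I i j p = α I i j q) ∧
            ∀ C₀ : ℝ, Cstar ≤ C₀ →
              ContDiffOn ℝ ∞ (β I i j) (TaubNUT.region A C₀ I) ∧
              (∀ p ∈ TaubNUT.region A C₀ I,
                TaubNUT.laplacianA A (β I i j) p = 0 ∧
                ENNReal.ofReal |β I i j p| ≤
                  ENNReal.ofReal C / TaubNUT.distA A p (TaubNUT.stratumBoundary I)) ∧
              -- comparison for `|J| = |I| + 1`
              (∀ J : Finset (Fin (N + 1)), I ⊂ J → J.card = I.card + 1 →
                ∀ p ∈ TaubNUT.region A C₀ I,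
                  ENNReal.ofReal |β I i j p - β J i j p| ≤
                    ENNReal.ofReal C / TaubNUT.distA A p (TaubNUT.stratum J) ∧
                  (p ∈ TaubNUT.finiteSet i j →
                    |β I i j p - β J i j p| = |α I i j p - α J i j p| ∧
                    ENNReal.ofReal |α I i j p - α J i j p| ≤
                      ENNReal.ofReal C / TaubNUT.distA A p (TaubNUT.stratum J))) ∧
              -- comparison for general `I ⊊ J`
              (∀ J : Finset (Fin (N + 1)), I ⊂ J →
                ∀ p ∈ TaubNUT.region A C₀ I,
                  ENNReal.ofReal |β I i j p - β J i j p| ≤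
                    (⨆ K : Finset (Fin (N + 1)), ⨆ _ : I ⊆ K ∧ K ⊆ J ∧ K.card = I.card + 1,
                      ENNReal.ofReal C / TaubNUT.distA A p (TaubNUT.stratum K)) ∧
                  (p ∈ TaubNUT.finiteSet i j →
                    |β I i j p - β J i j p| = |α I i j p - α J i j p| ∧
                    ENNReal.ofReal |α I i j p - α J i j p| ≤
                      ⨆ K : Finset (Fin (N + 1)), ⨆ _ : I ⊆ K ∧ K ⊆ J ∧ K.card = I.card + 1,
                        ENNReal.ofReal C / TaubNUT.distA A p (TaubNUT.stratum K))) := by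
  have hLam0 : 0 < Lam := hlam.trans_le hLam
  obtain ⟨C, hC0, hC⟩ := TaubNUT.exists_betaPart_sub_le N lam Lam hlam hLam0
  refine ⟨TaubNUT.regionConst N lam Lam, le_max_left _ _, C, hC0, fun A hsymm hbd => ?_⟩
  have hA : TaubNUT.IsPinched A lam Lam := ⟨hsymm, hlam, hbd⟩
  refine ⟨TaubNUT.alphaPart A, TaubNUT.betaPart A,
    fun I _ i j h p => TaubNUT.parts_of_notMem h p, fun I _ i hi j hj =>
    ⟨fun p hp => by rw [TaubNUT.betaPart_of_mem_finiteSet I hp]; ring,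
      fun p q h hη => TaubNUT.alphaPart_eq_of_mu_sub_eq hi hj h hη, fun C₀ hC₀ => ?_⟩⟩
  -- The regions shrink as `C₀` grows, so the threshold constant suffices.
  have hreg := TaubNUT.region_anti (A := A) hC₀ I
  have hdiff : ∀ J p, p ∈ TaubNUT.finiteSet i j →
      |TaubNUT.betaPart A I i j p - TaubNUT.betaPart A J i j p| =
        |TaubNUT.alphaPart A I i j p - TaubNUT.alphaPart A J i j p| := fun J p hp => by
    rw [TaubNUT.betaPart_of_mem_finiteSet I hp, TaubNUT.betaPart_of_mem_finiteSet J hp,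
      sub_sub_sub_cancel_left, abs_sub_comm]
  refine ⟨(hA.contDiffOn_betaPart hLam0 hi hj).mono hreg,
    fun p hp => ⟨hA.laplacianA_betaPart hLam0 hi hj (hreg hp), ?_⟩,
    fun J hIJ hJ p hp => ?_, fun J hIJ p hp => ?_⟩
  -- For the full index set the remainder is zero. Otherwise compare with `J = univ`: since `D_K ⊆
  -- ∂D_I`, the distance to `∂D_I` is the smaller one.
  · by_cases hI : I = Finset.univ
    · subst hI
      simp [TaubNUT.betaPart_univ hA]
    · obtain ⟨K, -, hIK, hle⟩ :=
        hC A hA I Finset.univ (Finset.ssubset_univ_iff.2 hI) i hi j hj p (hreg hp)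
      rw [TaubNUT.betaPart_univ hA, sub_zero] at hle
      exact hle.trans (ENNReal.div_le_div_left (TaubNUT.distA_boundary_le hIK p) _)
  · obtain ⟨K, ⟨-, hKJ, hK⟩, -, hle⟩ := hC A hA I J hIJ i hi j hj p (hreg hp)
    -- When `|J| = |I| + 1`, the only intermediate `K` of that size is `J`.
    obtain rfl : K = J := Finset.eq_of_subset_of_card_le hKJ (by omega)
    exact ⟨hle, fun hf => ⟨hdiff K p hf, hdiff K p hf ▸ hle⟩⟩
  · obtain ⟨K, hK, -, hle⟩ := hC A hA I J hIJ i hi j hj p (hreg hp)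
    have hle' := hle.trans (le_iSup₂ (f := fun (K : Finset (Fin (N + 1)))
      (_ : I ⊆ K ∧ K ⊆ J ∧ K.card = I.card + 1) =>
        ENNReal.ofReal C / TaubNUT.distA A p (TaubNUT.stratum K)) K hK)
    exact ⟨hle', fun hf => ⟨hdiff J p hf, hdiff J p hf ▸ hle'⟩⟩
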